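/- Let $R$ be an integral domain with quotient field $K$, $R\neq K$. For a nonzero fractional ideal $I$ of a domain $D$ with quotient field $K$ write $(D:I)=\{x\in K : xI\subseteq D\}$, $I_v=(D:(D:I))$, and $I_t=\bigcup J_v$, the union taken over the nonzero finitely generated fractional ideals $J\subseteq I$. A nonzero ideal $I$ with $I=I_t$ is a $t$-ideal; a $t$-prime is a prime $t$-ideal; $t\text{-Spec}(D)$ is the set of $t$-primes and $t\text{-Max}(D)$ is the set of maximal elements among the proper (integral) $t$-ideals of $D$ (these are prime). Put $I_w=\bigcap_{M\in t\text{-Max}(D)} I D_M$; a $w$-ideal is a nonzero fractional ideal $I$ with $I=I_w$, and $I$ is divisorial if $I=I_v$. The domain $D$ is divisorial if each nonzero ideal of $D$ is divisorial, $w$-divisorial if each $w$-ideal of $D$ is divisorial, and strongly $w$-divisorial if it is $w$-divisorial and $D_P$ is a divisorial domain for each $P\in t\text{-Spec}(D)$. For a nonempty set $\Lambda$ of nonzero prime ideals of $R$ let $\mathcal F(\Lambda)=\{J \text{ an ideal of } R : J\not\subseteq P \text{ for each } P\in\Lambda\}$ and $R_{\mathcal F(\Lambda)}=\bigcup\{(R:J)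 : J\in\mathcal F(\Lambda)\}$ $(=\bigcap_{P\in\Lambda}R_P)$. A $t$-subintersection of $R$ is an overring of the form $R_{\mathcal F(\Lambda)}$ with $\emptyset\neq\Lambda\subseteq t\text{-Spec}(R)$. The set $\Lambda$ is of finite character if each nonzero element of $R$ belongs to at most finitely many members of $\Lambda$, and independent if no two distinct members of $\Lambda$ contain a common nonzero prime ideal. **Theorem.** The following conditions are equivalent: (1) each $t$-subintersection of $R$ is strongly $w$-divisorial; (2) $R$ is a strongly $w$-divisorial domain, $R$ satisfies the ascending chain condition on $t$-prime ideals, and each nonempty family $\Lambda$ of pairwise incomparable $t$-primes of $R$ is independent of finite character (that is, independent and of finite character). -/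

import Mathlib

open scoped nonZeroDivisors

namespace WDiv

section Closures

variable {R : Type*} [CommRing R] [IsDomain R] {K : Type*} [Field K] [Algebra R K]
  [IsFractionRing R K]

/-- `I_v = (R : (R : I))`, for a nonzero fractional ideal `I` of `R`.  In Mathlib `1 / I` is the
fractional ideal `(R : I) = {x ∈ K | x I ⊆ R}` for `I ≠ 0` (and `1 / 0 = 0`, so that `0_v = 0`). -/
noncomputable def vClosure (I : FractionalIdeal R⁰ K) : FractionalIdeal R⁰ K :=
  1 / (1 / I)

theorem zero_vClosure : vClosure (0 : FractionalIdeal R⁰ K) = 0 := by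
  simp [vClosure, FractionalIdeal.div_zero]

theorem one_div_ne_zero' {I : FractionalIdeal R⁰ K} (hI : I ≠ 0) : 1 / I ≠ 0 := by
  intro h
  obtain ⟨a, ha, h1⟩ := I.isFractional
  have hmem : algebraMap R K a ∈ 1 / I := by
    rw [FractionalIdeal.mem_div_iff_of_ne_zero hI]
    intro y hy
    obtain ⟨r, hr⟩ := h1 y hy
    rw [FractionalIdeal.mem_one_iff]
    exact ⟨r, by rw [hr, Algebra.smul_def]⟩
  rw [h, FractionalIdeal.mem_zero_iff] at hmem
  exact nonZeroDivisors.ne_zero ha ((FaithfulSMul.algebraMap_eq_zero_iff R K).1 hmem)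

theorem vClosure_mono {I J : FractionalIdeal R⁰ K} (h : I ≤ J) : vClosure I ≤ vClosure J := by
  by_cases hI : I = 0
  · subst hI
    rw [zero_vClosure]
    exact FractionalIdeal.zero_le _
  have hJ : J ≠ 0 := by
    rintro rfl
    exact hI (FractionalIdeal.le_zero_iff.1 h)
  have h1 : 1 / J ≤ 1 / I := fun x hx => by
    rw [FractionalIdeal.mem_div_iff_of_ne_zero hJ] at hx
    rw [FractionalIdeal.mem_div_iff_of_ne_zero hI]
    exact fun y hy => hx y (h hy)
  intro x hx
  rw [vClosure, FractionalIdeal.mem_div_iff_of_ne_zero (one_div_ne_zero' hI)] at hx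
  rw [vClosure, FractionalIdeal.mem_div_iff_of_ne_zero (one_div_ne_zero' hJ)]
  exact fun y hy => hx y (h1 hy)

/-- The set `⋃ J_v`, over the finitely generated fractional ideals `J ⊆ I`, as a submodule.
(The zero ideal `J = 0` contributes only the element `0`.) -/
noncomputable def tSubmodule (I : FractionalIdeal R⁰ K) : Submodule R K where
  carrier := {x | ∃ J : FractionalIdeal R⁰ K, (J : Submodule R K).FG ∧ J ≤ I ∧ x ∈ vClosure J}
  zero_mem' := ⟨0, by simpa using Submodule.fg_bot, FractionalIdeal.zero_le I, by
    rw [zero_vClosure]; exact (FractionalIdeal.mem_zero_iff _).2 rfl⟩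
  add_mem' := by
    rintro x y ⟨J, hJ, hJI, hx⟩ ⟨L, hL, hLI, hy⟩
    refine ⟨J ⊔ L, ?_, sup_le hJI hLI, ?_⟩
    · rw [FractionalIdeal.coe_sup]
      exact hJ.sup hL
    · exact Submodule.add_mem (vClosure (J ⊔ L) : Submodule R K)
        (vClosure_mono le_sup_left hx) (vClosure_mono le_sup_right hy)
  smul_mem' := by
    rintro c x ⟨J, hJ, hJI, hx⟩
    exact ⟨J, hJ, hJI, Submodule.smul_mem (vClosure J : Submodule R K) c hx⟩

theorem isFractional_tSubmodule (I : FractionalIdeal R⁰ K) :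
    IsFractional R⁰ (tSubmodule I) := by
  obtain ⟨a, ha, h⟩ := (vClosure I).isFractional
  exact ⟨a, ha, fun x ⟨_, _, hJI, hx⟩ => h x (vClosure_mono hJI hx)⟩

/-- `I_t = ⋃ J_v`, over the finitely generated `J ⊆ I`. -/
noncomputable def tClosure (I : FractionalIdeal R⁰ K) : FractionalIdeal R⁰ K :=
  ⟨tSubmodule I, isFractional_tSubmodule I⟩

end Closures

section Primes

variable {R : Type*} [CommRing R] [IsDomain R] (K : Type*) [Field K] [Algebra R K]
  [IsFractionRing R K]

/-- An integral ideal `I` of `R` is a `t`-ideal: it is nonzero and `I_t = I`. -/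
def IsTIdeal (I : Ideal R) : Prop :=
  I ≠ ⊥ ∧ tClosure (I : FractionalIdeal R⁰ K) = (I : FractionalIdeal R⁰ K)

variable (R) in
/-- `t-Spec(R)`: the set of `t`-primes, that is, of the (nonzero) prime `t`-ideals. -/
def tSpec : Set (PrimeSpectrum R) :=
  {P | IsTIdeal K P.asIdeal}

variable (R) in
/-- `t-Max(R)`: the set of ideals that are maximal among all proper `t`-ideals of `R`.  As usual
these are regarded as points of the spectrum (a `t`-maximal ideal is always prime). -/
def tMax : Set (PrimeSpectrum R) :=
  {M | Maximal (fun I : Ideal R => I ≠ ⊤ ∧ IsTIdeal K I) M.asIdeal}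

/-- The localization `R_P`, as a subring of the quotient field `K`. -/
noncomputable def localAt (P : PrimeSpectrum R) : Subalgebra R K :=
  Localization.subalgebra.ofField K P.asIdeal.primeCompl P.asIdeal.primeCompl_le_nonZeroDivisors

variable {K} in
/-- `I_w = ⋂ I R_M`, over `M ∈ t-Max(R)`. -/
noncomputable def wClosure (I : FractionalIdeal R⁰ K) : Submodule R K :=
  ⨅ M ∈ tMax R K, (I : Submodule R K) * Subalgebra.toSubmodule (localAt K M)

end Primes

section Domains

variable (R : Type*) [CommRing R] [IsDomain R] (K : Type*) [Field K] [Algebra R K]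
  [IsFractionRing R K]

/-- `R`, with quotient field `K`, is a divisorial domain: each nonzero ideal is divisorial. -/
def IsDivisorialDomain : Prop :=
  ∀ I : Ideal R, I ≠ ⊥ → vClosure (I : FractionalIdeal R⁰ K) = (I : FractionalIdeal R⁰ K)

/-- `R` is `w`-divisorial: each `w`-ideal (nonzero fractional ideal `I` with `I_w = I`) is
divisorial. -/
def IsWDivisorial : Prop :=
  ∀ I : FractionalIdeal R⁰ K, I ≠ 0 → wClosure I = (I : Submodule R K) → vClosure I = I

/-- `R` is strongly `w`-divisorial: it is `w`-divisorial and `R_P` is a divisorial domain for each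
`t`-prime `P`. -/
def IsStronglyWDivisorial : Prop :=
  IsWDivisorial R K ∧ ∀ P ∈ tSpec R K, IsDivisorialDomain (localAt K P) K

end Domains

section Families

variable {R : Type*} [CommRing R]

/-- Finite character: each nonzero element lies in at most finitely many members. -/
def FiniteCharacter (L : Set (PrimeSpectrum R)) : Prop :=
  ∀ x : R, x ≠ 0 → {P ∈ L | x ∈ P.asIdeal}.Finite

/-- Independent: no two (distinct) members contain a common nonzero prime ideal. -/
def Independent (L : Set (PrimeSpectrum R)) : Prop :=
  ∀ P ∈ L, ∀ Q ∈ L, P ≠ Q →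
    ¬ ∃ N : Ideal R, N.IsPrime ∧ N ≠ ⊥ ∧ N ≤ P.asIdeal ∧ N ≤ Q.asIdeal

/-- A multiplicative system of ideals: a nonempty set of nonzero ideals closed under products. -/
structure IsMultiplicativeSystem (F : Set (Ideal R)) : Prop where
  nonempty : F.Nonempty
  ne_bot : ∀ J ∈ F, J ≠ ⊥
  mul_mem : ∀ I ∈ F, ∀ J ∈ F, I * J ∈ F

/-- `F(L)`: the ideals of `R` that are contained in no member of `L`. -/
def idealSystem (L : Set (PrimeSpectrum R)) : Set (Ideal R) :=
  {J | ∀ P ∈ L, ¬ J ≤ P.asIdeal}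

theorem isMultiplicativeSystem_idealSystem {L : Set (PrimeSpectrum R)} (hL : L.Nonempty) :
    IsMultiplicativeSystem (idealSystem L) where
  nonempty := ⟨⊤, fun P _ h => P.isPrime.ne_top (top_le_iff.1 h)⟩
  ne_bot := by
    rintro J hJ rfl
    obtain ⟨P, hP⟩ := hL
    exact hJ P hP bot_le
  mul_mem := fun I hI J hJ P hP h => (P.isPrime.mul_le.1 h).elim (hI P hP) (hJ P hP)

variable [IsDomain R] (K : Type*) [Field K] [Algebra R K] [IsFractionRing R K]

variable {K} in
theorem mem_one_div_coeIdeal {J : Ideal R} (hJ : J ≠ ⊥) {x : K} :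
    x ∈ 1 / (J : FractionalIdeal R⁰ K) ↔
      ∀ j ∈ J, ∃ r : R, algebraMap R K r = x * algebraMap R K j := by
  rw [FractionalIdeal.mem_div_iff_of_ne_zero (FractionalIdeal.coeIdeal_ne_zero.2 hJ)]
  constructor
  · intro h j hj
    exact (FractionalIdeal.mem_one_iff _).1 (h _ (FractionalIdeal.mem_coeIdeal_of_mem _ hj))
  · intro h y hy
    obtain ⟨j, hj, rfl⟩ := (FractionalIdeal.mem_coeIdeal _).1 hy
    exact (FractionalIdeal.mem_one_iff _).2 (h j hj)

variable {K} in
theorem mul_mem_colon {F : Set (Ideal R)} (hF : IsMultiplicativeSystem F) {x y : K}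
    (hx : ∃ J ∈ F, x ∈ 1 / (J : FractionalIdeal R⁰ K))
    (hy : ∃ J ∈ F, y ∈ 1 / (J : FractionalIdeal R⁰ K)) :
    ∃ J ∈ F, x * y ∈ 1 / (J : FractionalIdeal R⁰ K) := by
  obtain ⟨I, hI, hx⟩ := hx
  obtain ⟨J, hJ, hy⟩ := hy
  rw [mem_one_div_coeIdeal (hF.ne_bot I hI)] at hx
  rw [mem_one_div_coeIdeal (hF.ne_bot J hJ)] at hy
  refine ⟨I * J, hF.mul_mem I hI J hJ, ?_⟩
  rw [mem_one_div_coeIdeal (hF.ne_bot _ (hF.mul_mem I hI J hJ))]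
  intro z hz
  induction hz using Submodule.mul_induction_on' with
  | mem_mul_mem i hi j hj =>
    obtain ⟨r, hr⟩ := hx i hi
    obtain ⟨s, hs⟩ := hy j hj
    exact ⟨r * s, by rw [map_mul, map_mul, hr, hs]; ring⟩
  | add a _ b _ ha hb =>
    obtain ⟨r, hr⟩ := ha
    obtain ⟨s, hs⟩ := hb
    exact ⟨r + s, by rw [map_add, map_add, hr, hs]; ring⟩

variable {K} in
theorem add_mem_colon {F : Set (Ideal R)} (hF : IsMultiplicativeSystem F) {x y : K}
    (hx : ∃ J ∈ F, x ∈ 1 / (J : FractionalIdeal R⁰ K))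
    (hy : ∃ J ∈ F, y ∈ 1 / (J : FractionalIdeal R⁰ K)) :
    ∃ J ∈ F, x + y ∈ 1 / (J : FractionalIdeal R⁰ K) := by
  obtain ⟨I, hI, hx⟩ := hx
  obtain ⟨J, hJ, hy⟩ := hy
  rw [mem_one_div_coeIdeal (hF.ne_bot I hI)] at hx
  rw [mem_one_div_coeIdeal (hF.ne_bot J hJ)] at hy
  refine ⟨I * J, hF.mul_mem I hI J hJ, ?_⟩
  rw [mem_one_div_coeIdeal (hF.ne_bot _ (hF.mul_mem I hI J hJ))]
  intro z hz
  have hzI : z ∈ I := (Ideal.mul_le_left : I * J ≤ I) hz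
  have hzJ : z ∈ J := (Ideal.mul_le_right : I * J ≤ J) hz
  obtain ⟨r, hr⟩ := hx z hzI
  obtain ⟨s, hs⟩ := hy z hzJ
  exact ⟨r + s, by rw [map_add, hr, hs, add_mul]⟩

theorem algebraMap_mem_colon {F : Set (Ideal R)} (hF : IsMultiplicativeSystem F) (r : R) :
    ∃ J ∈ F, algebraMap R K r ∈ 1 / (J : FractionalIdeal R⁰ K) := by
  obtain ⟨J, hJ⟩ := hF.nonempty
  refine ⟨J, hJ, ?_⟩
  rw [mem_one_div_coeIdeal (hF.ne_bot J hJ)]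
  exact fun j _ => ⟨r * j, map_mul _ _ _⟩

/-- `R_F = ⋃ (R : J)`, over `J ∈ F`: the generalized ring of fractions of `R` with respect to a
multiplicative system `F` of ideals. -/
noncomputable def genFractionRing (F : Set (Ideal R)) (hF : IsMultiplicativeSystem F) :
    Subalgebra R K where
  carrier := {x | ∃ J ∈ F, x ∈ 1 / (J : FractionalIdeal R⁰ K)}
  mul_mem' := mul_mem_colon hF
  add_mem' := add_mem_colon hF
  algebraMap_mem' := algebraMap_mem_colon K hF

variable {K} in
/-- An overring `T` of `R` is a `t`-subintersection if `T = R_{F(L)}` for some nonempty set `L` of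
`t`-primes of `R`. -/
def IsTSubintersection (T : Subalgebra R K) : Prop :=
  ∃ (L : Set (PrimeSpectrum R)) (hL : L.Nonempty), L ⊆ tSpec R K ∧
    T = genFractionRing K (idealSystem L) (isMultiplicativeSystem_idealSystem hL)

end Families

end WDiv

/-!
The argument works with elements of the domain only. For a nonzero integral ideal `I`, the closure
`I_v` is `divClosure I`, the set of those `d` such that `c ∣ b * d` whenever `c` divides each
`b * j`, `j ∈ I`; a relation `x ∈ I R_P` is written `∃ s ∉ P, s * x ∈ I`. In this language `R` is
`w`-divisorial when `I_v ⊆ I R_M` for each `I ≠ 0` and each `t`-maximal `M` (`isWDivisorial_iff`).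

*A `w`-divisorial domain has an independent set of `t`-maximal ideals, of finite character*
(`DivClosureLeW.independent`, `DivClosureLeW.finiteCharacter`). A `t`-maximal ideal `M` is
divisorial, so `M = (cR : b)` for some fraction `b / c`, which does not lie in `R_M`. Let `a ≠ 0`
lie in a prime `Q ⊆ M ∩ N`. If each multiplier of `B = aR_M ∩ R` into `aR` were in `M`, then
`a b / c` would be in `B_v ⊆ aR_M`, which is absurd. So there is such a multiplier `u ∉ M`. Taking
`z ∈ N \ M` one finds `u ∈ (uz, a)_v ⊆ (uz, a)R_N`; as `z ∈ N`, this gives `u ∈ Q ⊆ M`, a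
contradiction. With independence at hand, the same comparison with `b / c`, applied to
`⋂ (aR_N ∩ R)` over all `N ≠ M`, gives an element outside `M` lying in `aR_N` for each `N ≠ M`.
These elements and `a` generate an ideal whose `t`-closure is `R`; finitely many of them suffice,
and each accounts for only one `t`-maximal ideal containing `a`.

*Conversely*, let `R = ⋂ R_P` over an independent family of finite character. For `P` in the family
and `c ≠ 0` there is `s ∉ P` such that `s / c` lies in `R_{P'}` for each other member `P'`. Hence
forming `(R : I)` commutes with localization at `P`, and `R` is `w`-divisorial as soon as the rings
`R_P` are divisorial (`divClosureLeW_of_locDivisorial`).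

For the equivalence, let `T = ⋂ R_P` over `P ∈ L` and let `center` send `P` to `P R_P ∩ T`, a prime
of `T` with the same localization as `P`. If `T` is `w`-divisorial, then each of its `t`-maximal
ideals is of the form `(cT : b)` with `b / c` outside some `R_P`, hence lies in the center of that
`P` (`exists_tMax_le_center`). On the other hand centers are `t`-primes when the rings `R_P` are
divisorial. So a nonempty `L` has a maximal member, which is the chain condition, and if `L` is an
antichain then its centers are `t`-maximal in `T`, so that `L` inherits independence and finite
character. Conversely, under the chain condition `L` may be replaced by its maximal members, and
the previous paragraph applies to `T` and their centers.
-/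

namespace WDiv

/-! ### Closures and localization in terms of divisibility -/

section DivisibilityClosures

variable {R : Type*} [CommRing R]

/-- The divisorial closure `I_v` of a nonzero integral ideal `I`, without mention of the quotient
field: `y = b / c` satisfies `y I ⊆ R` iff `c ∣ b * j` for each `j ∈ I`. -/
def divClosure (I : Ideal R) : Ideal R where
  carrier := {d | ∀ b c : R, c ≠ 0 → (∀ j ∈ I, c ∣ b * j) → c ∣ b * d}
  zero_mem' := fun b c _ _ => by simp
  add_mem' := fun hx hy b c hc h => by
    rw [mul_add]
    exact dvd_add (hx b c hc h) (hy b c hc h)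
  smul_mem' := fun r x hx b c hc h => by
    rw [smul_eq_mul, mul_left_comm]
    exact (hx b c hc h).mul_left r

theorem mem_divClosure {I : Ideal R} {d : R} :
    d ∈ divClosure I ↔ ∀ b c : R, c ≠ 0 → (∀ j ∈ I, c ∣ b * j) → c ∣ b * d :=
  Iff.rfl

theorem le_divClosure (I : Ideal R) : I ≤ divClosure I := fun d hd _ _ _ h => h d hd

theorem divClosure_mono {I J : Ideal R} (h : I ≤ J) : divClosure I ≤ divClosure J :=
  fun _ hd b c hc hJ => hd b c hc fun j hj => hJ j (h hj)

theorem divClosure_idem (I : Ideal R) : divClosure (divClosure I) ≤ divClosure I :=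
  fun _ hd b c hc h => hd b c hc fun _ hj => hj b c hc h

/-- The ideal `{s | c ∣ b * s}`, that is, `(cR : b)`. -/
def quotIdeal (c b : R) : Ideal R where
  carrier := {s | c ∣ b * s}
  zero_mem' := by simp
  add_mem' := fun hx hy => by
    rw [Set.mem_ofPred_eq, mul_add]
    exact dvd_add hx hy
  smul_mem' := fun r x hx => by
    rw [Set.mem_ofPred_eq, smul_eq_mul, mul_left_comm]
    exact hx.mul_left r

theorem mem_quotIdeal {c b s : R} : s ∈ quotIdeal c b ↔ c ∣ b * s := Iff.rfl

/-- The contraction `I R_P ∩ R` of the localization of `I` at the prime `P`. -/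
def locContraction (P : PrimeSpectrum R) (I : Ideal R) : Ideal R where
  carrier := {d | ∃ s ∉ P.asIdeal, s * d ∈ I}
  zero_mem' := ⟨1, P.isPrime.one_notMem, by simp⟩
  add_mem' := by
    rintro x y ⟨s, hs, hx⟩ ⟨t, ht, hy⟩
    refine ⟨s * t, P.isPrime.mul_notMem hs ht, ?_⟩
    have h : s * t * (x + y) = t * (s * x) + s * (t * y) := by ring
    rw [h]
    exact I.add_mem (I.mul_mem_left _ hx) (I.mul_mem_left _ hy)
  smul_mem' := by
    rintro r x ⟨s, hs, hx⟩
    refine ⟨s, hs, ?_⟩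
    rw [smul_eq_mul, mul_left_comm]
    exact I.mul_mem_left _ hx

theorem mem_locContraction {P : PrimeSpectrum R} {I : Ideal R} {d : R} :
    d ∈ locContraction P I ↔ ∃ s ∉ P.asIdeal, s * d ∈ I :=
  Iff.rfl

theorem mem_locContraction_span {P : PrimeSpectrum R} {c d : R} :
    d ∈ locContraction P (Ideal.span {c}) ↔ ∃ s ∉ P.asIdeal, c ∣ s * d := by
  simp only [mem_locContraction, Ideal.mem_span_singleton]

theorem le_locContraction (P : PrimeSpectrum R) (I : Ideal R) : I ≤ locContraction P I :=
  fun d hd => ⟨1, P.isPrime.one_notMem, by rwa [one_mul]⟩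

theorem mem_locContraction_of_mul_mem {P : PrimeSpectrum R} {I : Ideal R} {s d : R}
    (hs : s ∉ P.asIdeal) (h : s * d ∈ locContraction P I) : d ∈ locContraction P I := by
  obtain ⟨t, ht, h⟩ := h
  exact ⟨t * s, P.isPrime.mul_notMem ht hs, by rwa [mul_assoc]⟩

theorem locContraction_le_of_le {P Q : PrimeSpectrum R} {I : Ideal R} (hQP : Q ≤ P)
    (hI : I ≤ Q.asIdeal) : locContraction P I ≤ Q.asIdeal := by
  rintro d ⟨s, hs, h⟩
  exact (Q.isPrime.mem_or_mem (hI h)).resolve_left fun h => hs (hQP h)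

/-- `I` contains the divisorial closure of each finitely generated ideal inside it.  For `I ≠ 0`
this says that `I` is a `t`-ideal. -/
def IsTClosed (I : Ideal R) : Prop :=
  ∀ J : Ideal R, J.FG → J ≤ I → divClosure J ≤ I

theorem isTClosed_of_divClosure_le {I : Ideal R} (h : divClosure I ≤ I) : IsTClosed I :=
  fun _ _ hJ => (divClosure_mono hJ).trans h

theorem isTClosed_quotIdeal {c : R} (hc : c ≠ 0) (b : R) : IsTClosed (quotIdeal c b) :=
  isTClosed_of_divClosure_le fun _ hd => hd b c hc fun _ hj => hj

/-- The localization `R_P` is a divisorial domain: each ideal of `R_P` is extended from an ideal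
`I` of `R`, and the condition says that `(I R_P)_v ∩ R ⊆ I R_P ∩ R`. -/
def LocDivisorial (P : PrimeSpectrum R) : Prop :=
  ∀ I : Ideal R, I ≠ ⊥ → ∀ d : R,
    (∀ b c : R, c ≠ 0 → (∀ j ∈ I, b * j ∈ locContraction P (Ideal.span {c})) →
      b * d ∈ locContraction P (Ideal.span {c})) →
    d ∈ locContraction P I

/-- `R = ⋂ R_P` over `P ∈ L`: a fraction `b / c` that lies in each `R_P` lies in `R`. -/
def IsInterLocalizations (L : Set (PrimeSpectrum R)) : Prop :=
  ∀ b c : R, c ≠ 0 → (∀ P ∈ L, b ∈ locContraction P (Ideal.span {c})) → c ∣ b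

/-- Clearing denominators: a finitely generated `J ⊆ I R_P` is carried into `I` by one `s ∉ P`. -/
theorem exists_notMem_forall_mul_mem {P : PrimeSpectrum R} {I J : Ideal R} (hJ : J.FG)
    (h : J ≤ locContraction P I) : ∃ s ∉ P.asIdeal, ∀ j ∈ J, s * j ∈ I := by
  induction J, hJ using Submodule.fg_induction with
  | singleton x =>
    obtain ⟨s, hs, hx⟩ := h (Submodule.mem_span_singleton_self x)
    refine ⟨s, hs, fun j hj => ?_⟩
    obtain ⟨r, rfl⟩ := Submodule.mem_span_singleton.1 hj
    rw [smul_eq_mul, mul_left_comm]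
    exact I.mul_mem_left _ hx
  | sup J₁ _ J₂ _ h₁ h₂ =>
    obtain ⟨s, hs, h1⟩ := h₁ (le_sup_left.trans h)
    obtain ⟨t, ht, h2⟩ := h₂ (le_sup_right.trans h)
    refine ⟨s * t, P.isPrime.mul_notMem hs ht, fun j hj => ?_⟩
    obtain ⟨x, hx, y, hy, rfl⟩ := Submodule.mem_sup.1 hj
    have h : s * t * (x + y) = t * (s * x) + s * (t * y) := by ring
    rw [h]
    exact I.add_mem (I.mul_mem_left _ (h1 x hx)) (I.mul_mem_left _ (h2 y hy))

/-- If `R_P` is divisorial, then each nonzero prime inside `P` is a `t`-ideal: it is contracted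
from a divisorial ideal of `R_P`. -/
theorem LocDivisorial.isTClosed {P Q : PrimeSpectrum R} (hP : LocDivisorial P) (hQP : Q ≤ P)
    (hQ : Q.asIdeal ≠ ⊥) : IsTClosed Q.asIdeal := by
  intro J hJ hJQ d hd
  refine locContraction_le_of_le hQP le_rfl (hP Q.asIdeal hQ d fun b c hc h => ?_)
  -- a common denominator for the generators of `J` turns divisibility in `R_P` into one in `R`
  have hJ' : (Ideal.span {b} * J) ≤ locContraction P (Ideal.span {c}) := by
    rw [Ideal.span_singleton_mul_le_iff]
    exact fun z hz => h z (hJQ hz)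
  obtain ⟨s, hs, hsJ⟩ := exists_notMem_forall_mul_mem
    (Submodule.FG.mul (Submodule.fg_span_singleton b) hJ) hJ'
  refine mem_locContraction_span.2 ⟨s, hs, ?_⟩
  rw [← mul_assoc]
  refine hd _ c hc fun j hj => ?_
  rw [mul_assoc, ← Ideal.mem_span_singleton]
  exact hsJ _ (Ideal.mul_mem_mul (Ideal.mem_span_singleton_self b) hj)

theorem isTClosed_comap_ringEquiv {A B : Type*} [CommRing A] [CommRing B] (e : A ≃+* B)
    {I : Ideal B} (hI : IsTClosed I) : IsTClosed (I.comap (e : A →+* B)) := by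
  intro J hJ hJI d hd
  refine hI (J.map (e : A →+* B)) (hJ.map _) (Ideal.map_le_iff_le_comap.2 hJI) ?_
  intro b c hc h
  have h1 := hd (e.symm b) (e.symm c) (by simpa using hc) fun j hj => by
    have h2 := map_dvd e.symm (h (e j) (Ideal.mem_map_of_mem _ hj))
    simpa using h2
  simpa using map_dvd e h1

end DivisibilityClosures

/-! ### Divisibility and the closures of fractional ideals -/

section Bridge

/-- The dictionary between fractions and divisibility: `(b / c) d ∈ R` if and only if `c ∣ b * d`. -/
theorem mul_mem_range_iff {R : Type*} [CommRing R] {K : Type*} [Field K] [Algebra R K]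
    [IsFractionRing R K] {b c d : R} (hc : c ≠ 0) :
    (∃ r : R, algebraMap R K r = algebraMap R K b / algebraMap R K c * algebraMap R K d) ↔
      c ∣ b * d := by
  have hc' : algebraMap R K c ≠ 0 := by simpa using hc
  constructor
  · rintro ⟨r, hr⟩
    refine ⟨r, IsFractionRing.injective R K ?_⟩
    rw [map_mul, map_mul, hr]
    field_simp
  · rintro ⟨r, hr⟩
    refine ⟨r, ?_⟩
    have := congrArg (algebraMap R K) hr
    rw [map_mul, map_mul] at this
    field_simp
    rw [mul_comm, ← this]

variable {R : Type*} [CommRing R] [IsDomain R] {K : Type*} [Field K] [Algebra R K]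
  [IsFractionRing R K]

theorem mem_vClosure_coeIdeal {I : Ideal R} (hI : I ≠ ⊥) {x : K} :
    x ∈ vClosure (I : FractionalIdeal R⁰ K) ↔ ∃ d ∈ divClosure I, algebraMap R K d = x := by
  have hI' : (I : FractionalIdeal R⁰ K) ≠ 0 := FractionalIdeal.coeIdeal_ne_zero.2 hI
  rw [vClosure, FractionalIdeal.mem_div_iff_of_ne_zero (one_div_ne_zero' hI')]
  constructor
  · intro h
    have h1 : (1 : K) ∈ 1 / (I : FractionalIdeal R⁰ K) := by
      rw [mem_one_div_coeIdeal hI]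
      exact fun j _ => ⟨j, by simp⟩
    obtain ⟨d, hd⟩ := (FractionalIdeal.mem_one_iff _).1 (h 1 h1)
    rw [mul_one] at hd
    subst hd
    refine ⟨d, fun b c hc hb => ?_, rfl⟩
    rw [← mul_mem_range_iff (K := K) hc, mul_comm]
    refine (FractionalIdeal.mem_one_iff _).1 (h _ ?_)
    rw [mem_one_div_coeIdeal hI]
    exact fun j hj => (mul_mem_range_iff hc).2 (hb j hj)
  · rintro ⟨d, hd, rfl⟩ y hy
    rw [mem_one_div_coeIdeal hI] at hy
    obtain ⟨b, c, hc, rfl⟩ := IsFractionRing.div_surjective R y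
    have hc := nonZeroDivisors.ne_zero hc
    rw [FractionalIdeal.mem_one_iff, mul_comm, mul_mem_range_iff hc]
    exact hd b c hc fun j hj => (mul_mem_range_iff hc).1 (hy j hj)

theorem vClosure_coeIdeal {I : Ideal R} (hI : I ≠ ⊥) :
    vClosure (I : FractionalIdeal R⁰ K) = (divClosure I : Ideal R) := by
  ext x
  rw [mem_vClosure_coeIdeal hI, FractionalIdeal.mem_coeIdeal]

theorem isDivisorialDomain_iff :
    IsDivisorialDomain R K ↔ ∀ I : Ideal R, I ≠ ⊥ → divClosure I ≤ I := by
  refine forall_congr' fun I => forall_congr' fun hI => ?_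
  rw [vClosure_coeIdeal hI, FractionalIdeal.coeIdeal_inj]
  exact ⟨fun h => h.le, fun h => le_antisymm h (le_divClosure I)⟩

theorem isTIdeal_iff {I : Ideal R} : IsTIdeal K I ↔ I ≠ ⊥ ∧ IsTClosed I := by
  refine and_congr_right fun hI => ?_
  constructor
  · intro h J hJ hJI d hd
    by_cases hJ0 : J = ⊥
    · subst hJ0
      obtain ⟨c, hcI, hc⟩ := Submodule.exists_mem_ne_zero_of_ne_bot hI
      have h1 := hd 1 c hc fun j hj => by simp [(Submodule.mem_bot R).1 hj]
      rw [one_mul] at h1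
      exact I.mem_of_dvd h1 hcI
    have h1 : algebraMap R K d ∈ tClosure (I : FractionalIdeal R⁰ K) :=
      ⟨J, (FractionalIdeal.coeIdeal_fg R⁰ (IsFractionRing.injective R K) J).2 hJ,
        (FractionalIdeal.coeIdeal_le_coeIdeal K).2 hJI,
        (mem_vClosure_coeIdeal hJ0).2 ⟨d, hd, rfl⟩⟩
    rw [h, FractionalIdeal.mem_coeIdeal] at h1
    obtain ⟨d', hd', h2⟩ := h1
    rwa [← IsFractionRing.injective R K h2]
  · intro h
    ext x
    constructor
    · rintro ⟨J, hJ, hJI, hx⟩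
      obtain ⟨J', rfl⟩ := FractionalIdeal.le_one_iff_exists_coeIdeal.1
        (hJI.trans FractionalIdeal.coeIdeal_le_one)
      by_cases hJ0 : J' = ⊥
      · subst hJ0
        rw [FractionalIdeal.coeIdeal_bot, zero_vClosure, FractionalIdeal.mem_zero_iff] at hx
        rw [hx]
        exact Submodule.zero_mem _
      obtain ⟨d, hd, rfl⟩ := (mem_vClosure_coeIdeal hJ0).1 hx
      exact FractionalIdeal.mem_coeIdeal_of_mem _ (h J'
        ((FractionalIdeal.coeIdeal_fg R⁰ (IsFractionRing.injective R K) J').1 hJ)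
        ((FractionalIdeal.coeIdeal_le_coeIdeal K).1 hJI) hd)
    · intro hx
      obtain ⟨d, hd, rfl⟩ := (FractionalIdeal.mem_coeIdeal _).1 hx
      by_cases hd0 : d = 0
      · subst hd0
        rw [map_zero]
        exact Submodule.zero_mem (tSubmodule (I : FractionalIdeal R⁰ K))
      refine ⟨(Ideal.span {d} : Ideal R), ?_, ?_, ?_⟩
      · exact (FractionalIdeal.coeIdeal_fg R⁰ (IsFractionRing.injective R K) _).2
          (Submodule.fg_span_singleton d)
      · rw [FractionalIdeal.coeIdeal_le_coeIdeal, Ideal.span_singleton_le_iff_mem]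
        exact hd
      · refine (mem_vClosure_coeIdeal (by simpa using hd0)).2 ⟨d, le_divClosure _ ?_, rfl⟩
        exact Ideal.mem_span_singleton_self d

end Bridge

/-! ### `t`-maximal ideals -/

section TMaximal

variable {R : Type*} [CommRing R]

theorem isTClosed_of_le_chain {C : Set (Ideal R)} (hne : C.Nonempty)
    (hC : IsChain (· ≤ ·) C) (h : ∀ I ∈ C, IsTClosed I) : IsTClosed (sSup C) := by
  intro J hJ hJC
  obtain ⟨S, rfl⟩ := hJ
  have hS : ∃ I ∈ C, (S : Set R) ⊆ I :=
    DirectedOn.exists_mem_subset_of_finset_subset_biUnion (f := fun I : Ideal R => (I : Set R))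
      hne hC.directedOn fun x hx => by
        obtain ⟨I, hI, hxI⟩ := (Submodule.mem_sSup_of_directed hne hC.directedOn).1
          (hJC (Submodule.subset_span hx))
        exact Set.mem_biUnion hI hxI
  obtain ⟨I, hI, hSI⟩ := hS
  exact (h I hI _ ⟨S, rfl⟩ (Submodule.span_le.2 hSI)).trans (le_sSup hI)

theorem exists_le_maximal_isTClosed {I : Ideal R} (hI : I ≠ ⊤) (hI' : IsTClosed I) :
    ∃ M, I ≤ M ∧ Maximal (fun J : Ideal R => J ≠ ⊤ ∧ IsTClosed J) M := by
  have hub : ∀ C ⊆ {J : Ideal R | J ≠ ⊤ ∧ IsTClosed J}, IsChain (· ≤ ·) C → ∀ y ∈ C,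
      ∃ ub ∈ {J : Ideal R | J ≠ ⊤ ∧ IsTClosed J}, ∀ z ∈ C, z ≤ ub := by
    intro C hC hch y hy
    refine ⟨sSup C, ⟨fun h => ?_, isTClosed_of_le_chain ⟨y, hy⟩ hch fun J hJ => (hC hJ).2⟩,
      fun z hz => le_sSup hz⟩
    obtain ⟨J, hJ, h1⟩ := (Submodule.mem_sSup_of_directed ⟨y, hy⟩ hch.directedOn).1
      ((Ideal.eq_top_iff_one _).1 h)
    exact (hC hJ).1 ((Ideal.eq_top_iff_one _).2 h1)
  obtain ⟨M, hIM, hM⟩ := zorn_le_nonempty₀ _ hub I ⟨hI, hI'⟩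
  exact ⟨M, hIM, hM⟩

/-- The `t`-closure of an integral ideal. -/
def tIdealClosure (I : Ideal R) : Ideal R where
  carrier := {d | ∃ J : Ideal R, J.FG ∧ J ≤ I ∧ d ∈ divClosure J}
  zero_mem' := ⟨⊥, Submodule.fg_bot, bot_le, zero_mem _⟩
  add_mem' := by
    rintro x y ⟨J, hJ, hJI, hx⟩ ⟨L, hL, hLI, hy⟩
    exact ⟨J ⊔ L, Submodule.FG.sup hJ hL, sup_le hJI hLI,
      add_mem (divClosure_mono le_sup_left hx) (divClosure_mono le_sup_right hy)⟩
  smul_mem' := by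
    rintro c x ⟨J, hJ, hJI, hx⟩
    exact ⟨J, hJ, hJI, Submodule.smul_mem _ c hx⟩

theorem le_tIdealClosure (I : Ideal R) : I ≤ tIdealClosure I := fun d hd =>
  ⟨Ideal.span {d}, Submodule.fg_span_singleton d, (Ideal.span_singleton_le_iff_mem I).2 hd,
    le_divClosure _ (Ideal.mem_span_singleton_self d)⟩

theorem isTClosed_tIdealClosure (I : Ideal R) : IsTClosed (tIdealClosure I) := by
  intro J hJ hJI
  -- finitely many elements of the closure lie in `L_v` for a single finitely generated `L ⊆ I`
  have h : ∃ L : Ideal R, L.FG ∧ L ≤ I ∧ J ≤ divClosure L := by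
    induction J, hJ using Submodule.fg_induction with
    | singleton x =>
      obtain ⟨L, hL, hLI, hx⟩ := hJI (Submodule.mem_span_singleton_self x)
      exact ⟨L, hL, hLI, (Ideal.span_singleton_le_iff_mem _).2 hx⟩
    | sup J₁ _ J₂ _ h₁ h₂ =>
      obtain ⟨L₁, h1, h1', h1''⟩ := h₁ (le_sup_left.trans hJI)
      obtain ⟨L₂, h2, h2', h2''⟩ := h₂ (le_sup_right.trans hJI)
      exact ⟨L₁ ⊔ L₂, Submodule.FG.sup h1 h2, sup_le h1' h2',
        sup_le (h1''.trans (divClosure_mono le_sup_left))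
          (h2''.trans (divClosure_mono le_sup_right))⟩
  obtain ⟨L, hL, hLI, hJL⟩ := h
  exact fun d hd => ⟨L, hL, hLI, divClosure_idem L (divClosure_mono hJL hd)⟩

theorem mul_mem_divClosure_mul {I J : Ideal R} {x y : R} (hx : x ∈ divClosure I)
    (hy : y ∈ divClosure J) : x * y ∈ divClosure (I * J) := by
  intro b c hc h
  rw [← mul_assoc]
  refine hy _ c hc fun j hj => ?_
  rw [mul_right_comm]
  refine hx _ c hc fun i hi => ?_
  rw [mul_assoc, mul_comm j]
  exact h _ (Ideal.mul_mem_mul hi hj)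

theorem isPrime_of_maximal_isTClosed {M : Ideal R}
    (hM : Maximal (fun J : Ideal R => J ≠ ⊤ ∧ IsTClosed J) M) : M.IsPrime := by
  -- an element outside `M` generates with `M` an ideal whose `t`-closure is `R`
  have key : ∀ a ∉ M, ∃ J : Ideal R, J.FG ∧ J ≤ M ⊔ Ideal.span {a} ∧ 1 ∈ divClosure J := by
    intro a ha
    by_contra hcon
    have h1 : M ⊔ Ideal.span {a} ≤ M := (le_tIdealClosure _).trans
      (hM.2 ⟨fun h => hcon ((Ideal.eq_top_iff_one _).1 h), isTClosed_tIdealClosure _⟩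
        (le_sup_left.trans (le_tIdealClosure _)))
    exact ha (h1 (le_sup_right (a := M) (Ideal.mem_span_singleton_self a)))
  refine ⟨hM.1.1, fun {a b} hab => ?_⟩
  by_contra! hcon
  obtain ⟨J, hJ, hJM, h1⟩ := key a hcon.1
  obtain ⟨L, hL, hLM, h2⟩ := key b hcon.2
  refine hM.1.1 ((Ideal.eq_top_iff_one _).2 (hM.1.2 (J * L) (Submodule.FG.mul hJ hL) ?_ ?_))
  · refine (Ideal.mul_mono hJM hLM).trans ?_
    rw [Ideal.sup_mul, Ideal.mul_sup (Ideal.span {a}), Ideal.span_singleton_mul_span_singleton]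
    refine sup_le Ideal.mul_le_left (sup_le Ideal.mul_le_right ?_)
    exact (Ideal.span_singleton_le_iff_mem _).2 hab
  · simpa using mul_mem_divClosure_mul h1 h2

variable [IsDomain R] {K : Type*} [Field K] [Algebra R K] [IsFractionRing R K]

theorem mem_tSpec_iff {P : PrimeSpectrum R} :
    P ∈ tSpec R K ↔ P.asIdeal ≠ ⊥ ∧ IsTClosed P.asIdeal :=
  isTIdeal_iff

theorem mem_tSpec_of_mem_tMax {M : PrimeSpectrum R} (hM : M ∈ tMax R K) : M ∈ tSpec R K :=
  hM.1.2

theorem isTClosed_of_mem_tMax {M : PrimeSpectrum R} (hM : M ∈ tMax R K) :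
    IsTClosed M.asIdeal :=
  (isTIdeal_iff.1 hM.1.2).2

theorem ne_bot_of_mem_tMax {M : PrimeSpectrum R} (hM : M ∈ tMax R K) : M.asIdeal ≠ ⊥ :=
  hM.1.2.1

theorem exists_tMax_ge {I : Ideal R} (h0 : I ≠ ⊥) (hI : I ≠ ⊤) (hI' : IsTClosed I) :
    ∃ M ∈ tMax R K, I ≤ M.asIdeal := by
  obtain ⟨M, hIM, hM⟩ := exists_le_maximal_isTClosed hI hI'
  refine ⟨⟨M, isPrime_of_maximal_isTClosed hM⟩, ⟨⟨hM.1.1, isTIdeal_iff.2 ⟨?_, hM.1.2⟩⟩, ?_⟩, hIM⟩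
  · exact fun h => h0 (le_bot_iff.1 (h ▸ hIM))
  · exact fun J hJ hMJ => hM.2 ⟨hJ.1, (isTIdeal_iff.1 hJ.2).2⟩ hMJ

theorem eq_of_mem_tMax_of_le {M : PrimeSpectrum R} (hM : M ∈ tMax R K) {I : Ideal R}
    (hI : I ≠ ⊤) (hI' : IsTClosed I) (h : M.asIdeal ≤ I) : I = M.asIdeal := by
  refine le_antisymm (hM.2 ⟨hI, isTIdeal_iff.2 ⟨fun h0 => ?_, hI'⟩⟩ h) h
  exact ne_bot_of_mem_tMax hM (le_bot_iff.1 (h0 ▸ h))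

variable (R K) in
/-- `R` is the intersection of its localizations at the `t`-maximal ideals. -/
theorem isInterLocalizations_tMax : IsInterLocalizations (tMax R K) := by
  intro b c hc h
  by_contra hcb
  have h1 : quotIdeal c b ≠ ⊤ := fun h1 => hcb <| by
    have h2 := mem_quotIdeal.1 ((Ideal.eq_top_iff_one _).1 h1)
    rwa [mul_one] at h2
  have h0 : c ∈ quotIdeal c b := mem_quotIdeal.2 (dvd_mul_left c b)
  obtain ⟨M, hM, hle⟩ := exists_tMax_ge (K := K) (fun h2 => hc (by simpa [h2] using h0)) h1
    (isTClosed_quotIdeal hc b)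
  obtain ⟨s, hs, hsb⟩ := mem_locContraction_span.1 (h M hM)
  exact hs (hle (mem_quotIdeal.2 (by rwa [mul_comm])))

theorem exists_mem_notMem_of_mem_tMax {M N : PrimeSpectrum R} (hM : M ∈ tMax R K)
    (hN : N ∈ tMax R K) (h : M ≠ N) : ∃ z ∈ N.asIdeal, z ∉ M.asIdeal := by
  by_contra! hcon
  exact h (PrimeSpectrum.ext
    (eq_of_mem_tMax_of_le hN M.isPrime.ne_top (isTClosed_of_mem_tMax hM) hcon))

end TMaximal

/-! ### `t`-maximal ideals of a `w`-divisorial domain -/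

section WDivisorial

variable {R : Type*} [CommRing R] [IsDomain R] {K : Type*} [Field K] [Algebra R K]
  [IsFractionRing R K]

variable (R K) in
/-- The condition `I_v ⊆ I R_M` for each nonzero integral ideal `I` and each `t`-maximal ideal
`M`, that is, `I_v ⊆ I_w`. -/
def DivClosureLeW : Prop :=
  ∀ I : Ideal R, I ≠ ⊥ → ∀ M ∈ tMax R K, divClosure I ≤ locContraction M I

/-- A `t`-maximal ideal of a `w`-divisorial domain is of the form `(cR : b)`. -/
theorem DivClosureLeW.exists_eq_quotIdeal (H : DivClosureLeW R K) {M : PrimeSpectrum R}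
    (hM : M ∈ tMax R K) :
    ∃ b c : R, c ≠ 0 ∧ ¬ c ∣ b ∧ ∀ s, s ∈ M.asIdeal ↔ c ∣ b * s := by
  have h1 : (1 : R) ∉ divClosure M.asIdeal := fun h =>
    M.isPrime.one_notMem (locContraction_le_of_le le_rfl le_rfl
      (H _ (ne_bot_of_mem_tMax hM) M hM h))
  simp only [mem_divClosure, mul_one] at h1
  push Not at h1
  obtain ⟨b, c, hc, hbM, hcb⟩ := h1
  refine ⟨b, c, hc, hcb, fun s => ⟨hbM s, fun hs => ?_⟩⟩
  have h2 : quotIdeal c b = M.asIdeal := by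
    refine eq_of_mem_tMax_of_le hM (fun h => hcb ?_) (isTClosed_quotIdeal hc b) hbM
    have := mem_quotIdeal.1 ((Ideal.eq_top_iff_one _).1 h)
    rwa [mul_one] at this
  rw [← h2]
  exact hs

/-- If `R = ⋂ R_P` over `P ∈ L` is `w`-divisorial, then each `t`-maximal ideal of `R` lies inside a
member of `L`. -/
theorem DivClosureLeW.exists_ge_of_isInterLocalizations (H : DivClosureLeW R K)
    {L : Set (PrimeSpectrum R)} (hL : IsInterLocalizations L) {M : PrimeSpectrum R}
    (hM : M ∈ tMax R K) : ∃ P ∈ L, M ≤ P := by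
  obtain ⟨b, c, hc, hcb, hbM⟩ := H.exists_eq_quotIdeal hM
  by_contra! hcon
  refine hcb (hL b c hc fun P hP => mem_locContraction_span.2 ?_)
  obtain ⟨s, hs, hsP⟩ := SetLike.not_le_iff_exists.1
    (show ¬ M.asIdeal ≤ P.asIdeal from hcon P hP)
  exact ⟨s, hsP, by rw [mul_comm]; exact (hbM s).1 hs⟩

/-- The heart of independence: with `M = (cR : b)`, some multiplier of `aR_M ∩ R` into `aR` avoids
`M`, since otherwise `a b / c` would lie in `(aR_M ∩ R)_v`. -/
theorem DivClosureLeW.exists_notMem_forall_dvd (H : DivClosureLeW R K) {M : PrimeSpectrum R}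
    (hM : M ∈ tMax R K) {a : R} (ha : a ≠ 0) :
    ∃ u ∉ M.asIdeal, ∀ d ∈ locContraction M (Ideal.span {a}), a ∣ u * d := by
  by_contra! hcon
  have hcon : ∀ u, (∀ d ∈ locContraction M (Ideal.span {a}), a ∣ u * d) → u ∈ M.asIdeal := by
    intro u hu
    by_contra huM
    obtain ⟨d, hd, had⟩ := hcon u huM
    exact had (hu d hd)
  have haB : a ∈ locContraction M (Ideal.span {a}) :=
    le_locContraction _ _ (Ideal.mem_span_singleton_self a)
  have haM : a ∈ M.asIdeal := hcon a fun d _ => dvd_mul_right a d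
  obtain ⟨b, c, hc, hcb, hbM⟩ := H.exists_eq_quotIdeal hM
  -- `x = a b / c`
  obtain ⟨x, hx⟩ := (hbM a).1 haM
  have hxv : x ∈ divClosure (locContraction M (Ideal.span {a})) := by
    intro b' c' hc' h
    obtain ⟨u, hu⟩ := h a haB
    have huM : u ∈ M.asIdeal := hcon u fun d hd => by
      obtain ⟨k, hk⟩ := h d hd
      refine ⟨k, mul_left_cancel₀ hc' ?_⟩
      linear_combination (-d) * hu + a * hk
    obtain ⟨k, hk⟩ := (hbM u).1 huM
    refine ⟨k, mul_left_cancel₀ hc ?_⟩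
    linear_combination (-b') * hx + b * hu + c' * hk
  obtain ⟨s, hs, hsx⟩ := H _ (fun h => ha (by simpa [h] using haB)) M hM hxv
  obtain ⟨t, ht, k, hk⟩ := mem_locContraction_span.1 hsx
  refine M.isPrime.mul_notMem ht hs ((hbM _).2 ⟨k, mul_left_cancel₀ ha ?_⟩)
  linear_combination (t * s) * hx + c * hk

/-- In a `w`-divisorial domain two `t`-maximal ideals contain no common nonzero prime ideal. -/
theorem DivClosureLeW.independent (H : DivClosureLeW R K) : Independent (tMax R K) := by
  rintro M hM N hN hMN ⟨Q, hQ, hQ0, hQM, hQN⟩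
  obtain ⟨a, haQ, ha⟩ := Submodule.exists_mem_ne_zero_of_ne_bot hQ0
  obtain ⟨u, huM, hu⟩ := H.exists_notMem_forall_dvd hM ha
  obtain ⟨z, hzN, hzM⟩ := exists_mem_notMem_of_mem_tMax hM hN hMN
  -- the multiplier `u` lies in `(uz, a)_v`, hence in `(uz, a)R_N`, where `1 - z r` is a unit
  have huv : u ∈ divClosure (Ideal.span {u * z, a}) := by
    intro b c hc h
    obtain ⟨p, hp⟩ := h a (Ideal.subset_span (by simp))
    obtain ⟨q, hq⟩ := h (u * z) (Ideal.subset_span (by simp))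
    have hpB : p ∈ locContraction M (Ideal.span {a}) :=
      mem_locContraction_span.2 ⟨u * z, M.isPrime.mul_notMem huM hzM, q, mul_left_cancel₀ hc (by
        linear_combination (-(u * z)) * hp + a * hq)⟩
    obtain ⟨k, hk⟩ := hu p hpB
    refine ⟨k, mul_left_cancel₀ ha ?_⟩
    linear_combination u * hp + c * hk
  have hI0 : Ideal.span {u * z, a} ≠ ⊥ := fun h => ha (by
    have h1 : a ∈ Ideal.span {u * z, a} := Ideal.subset_span (by simp)
    simpa [h] using h1)
  obtain ⟨s, hsN, hs⟩ := H _ hI0 N hN huv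
  obtain ⟨α, β, h⟩ := Ideal.mem_span_pair.1 hs
  have h1 : (s - α * z) * u ∈ Q := by
    have h2 : (s - α * z) * u = β * a := by linear_combination -h
    rw [h2]
    exact Q.mul_mem_left _ haQ
  rcases hQ.mem_or_mem h1 with h2 | h2
  · refine hsN ?_
    have h3 := N.asIdeal.add_mem (hQN h2) (N.asIdeal.mul_mem_left α hzN)
    rwa [sub_add_cancel] at h3
  · exact huM (hQM h2)

/-- If no nonzero prime lies in both `M` and `N`, then `R_M R_N` is the quotient field. -/
theorem exists_dvd_mul_of_no_common_prime {R : Type*} [CommRing R] {M N : PrimeSpectrum R}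
    (h : ¬ ∃ Q : Ideal R, Q.IsPrime ∧ Q ≠ ⊥ ∧ Q ≤ M.asIdeal ∧ Q ≤ N.asIdeal) {a : R}
    (ha : a ≠ 0) : ∃ s ∉ M.asIdeal, ∃ t ∉ N.asIdeal, a ∣ t * s := by
  by_contra! hcon
  have hd : Disjoint (Ideal.span {a} : Set R)
      ((M.asIdeal.primeCompl ⊔ N.asIdeal.primeCompl : Submonoid R) : Set R) := by
    rw [Set.disjoint_left]
    intro x hx hx'
    obtain ⟨s, hs, t, ht, rfl⟩ := Submonoid.mem_sup.1 hx'
    rw [mul_comm] at hx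
    exact hcon s hs t ht (Ideal.mem_span_singleton.1 hx)
  obtain ⟨Q, hQ, haQ, hQd⟩ := Ideal.exists_le_prime_disjoint _ _ hd
  rw [Set.disjoint_left] at hQd
  refine h ⟨Q, hQ, ?_, fun x hx => ?_, fun x hx => ?_⟩
  · rintro rfl
    exact ha (by simpa using haQ)
  · by_contra hxM
    exact hQd hx (Submonoid.mem_sup_left hxM)
  · by_contra hxN
    exact hQd hx (Submonoid.mem_sup_right hxN)

/-- In a `w`-divisorial domain `1 / a` is a fraction `r / s` with `s ∉ M` and
`r ∈ ⋂ R_N` over the other `t`-maximal ideals `N`. -/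
theorem DivClosureLeW.exists_notMem_mem_locContraction (H : DivClosureLeW R K)
    {M : PrimeSpectrum R} (hM : M ∈ tMax R K) {a : R} (ha : a ≠ 0) :
    ∃ s ∉ M.asIdeal, ∀ N ∈ tMax R K, N ≠ M → s ∈ locContraction N (Ideal.span {a}) := by
  by_contra! hcon
  have hcon : ∀ s, (∀ N ∈ tMax R K, N ≠ M → s ∈ locContraction N (Ideal.span {a})) →
      s ∈ M.asIdeal := by
    intro s hs
    by_contra hsM
    obtain ⟨N, hN, hNM, h⟩ := hcon s hsM
    exact h (hs N hN hNM)
  have haB : ∀ N, a ∈ locContraction N (Ideal.span {a}) := fun N =>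
    le_locContraction _ _ (Ideal.mem_span_singleton_self a)
  have haM : a ∈ M.asIdeal := hcon a fun N _ _ => haB N
  obtain ⟨N₀, hN₀, hN₀M⟩ : ∃ N ∈ tMax R K, N ≠ M := by
    by_contra! h
    exact M.isPrime.one_notMem (hcon 1 fun N hN hNM => (hNM (h N hN)).elim)
  obtain ⟨b, c, hc, hcb, hbM⟩ := H.exists_eq_quotIdeal hM
  obtain ⟨x, hx⟩ := (hbM a).1 haM
  -- `S` is `a` times the sum of the fractional ideals `(R : aR_N ∩ R)` over `N ≠ M`
  let S : Ideal R := Ideal.span {u | ∃ N ∈ tMax R K, N ≠ M ∧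
    ∀ d ∈ locContraction N (Ideal.span {a}), a ∣ u * d}
  have haS : a ∈ S := Ideal.subset_span ⟨N₀, hN₀, hN₀M, fun d _ => dvd_mul_right a d⟩
  have hxv : x ∈ divClosure S := by
    intro b' c' hc' h
    obtain ⟨p, hp⟩ := h a haS
    -- `p` lies in `(aR_N ∩ R)_v`, hence in `aR_N`, for each `N ≠ M`
    have hpM : p ∈ M.asIdeal := by
      refine hcon p fun N hN hNM => ?_
      have hpv : p ∈ divClosure (locContraction N (Ideal.span {a})) := by
        intro b'' c'' hc'' h'
        obtain ⟨u, hu⟩ := h' a (haB N)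
        have huS : u ∈ S := Ideal.subset_span ⟨N, hN, hNM, fun d hd => by
          obtain ⟨k, hk⟩ := h' d hd
          refine ⟨k, mul_left_cancel₀ hc'' ?_⟩
          linear_combination (-d) * hu + a * hk⟩
        obtain ⟨k, hk⟩ := h u huS
        refine ⟨k, mul_left_cancel₀ (mul_ne_zero ha hc') ?_⟩
        linear_combination (c' * p) * hu - (c'' * u) * hp + (c'' * a) * hk
      obtain ⟨s, hs, hsp⟩ := H _ (fun h => ha (by simpa [h] using haB N)) N hN hpv
      exact mem_locContraction_of_mul_mem hs hsp
    obtain ⟨k, hk⟩ := (hbM p).1 hpM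
    refine ⟨k, mul_left_cancel₀ hc ?_⟩
    linear_combination (-b') * hx + b * hp + c' * hk
  obtain ⟨s, hs, hsx⟩ := H _ (fun h => ha (by simpa [h] using haS)) M hM hxv
  -- by independence `S` lies in `aR_M`, but `x = a b / c` does not
  have hSM : S ≤ locContraction M (Ideal.span {a}) := by
    refine Ideal.span_le.2 ?_
    rintro u ⟨N, hN, hNM, hu⟩
    obtain ⟨t, ht, t', ht', htt⟩ :=
      exists_dvd_mul_of_no_common_prime (H.independent M hM N hN hNM.symm) ha
    refine mem_locContraction_span.2 ⟨t, ht, ?_⟩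
    rw [mul_comm]
    exact hu t (mem_locContraction_span.2 ⟨t', ht', htt⟩)
  obtain ⟨t, ht, k, hk⟩ := mem_locContraction_span.1 (hSM hsx)
  refine M.isPrime.mul_notMem ht hs ((hbM _).2 ⟨k, mul_left_cancel₀ ha ?_⟩)
  linear_combination (t * s) * hx + c * hk

/-- In a `w`-divisorial domain the set of `t`-maximal ideals is of finite character. -/
theorem DivClosureLeW.finiteCharacter (H : DivClosureLeW R K) : FiniteCharacter (tMax R K) := by
  intro a ha
  let G : Set R := {s | ∃ M ∈ tMax R K, s ∉ M.asIdeal ∧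
    ∀ N ∈ tMax R K, N ≠ M → s ∈ locContraction N (Ideal.span {a})}
  let J : Ideal R := Ideal.span (insert a G)
  -- `J` lies in no `t`-maximal ideal, so that its `t`-closure is `R`
  have h1 : (1 : R) ∈ tIdealClosure J := by
    by_contra h
    have haJ : a ∈ J := Ideal.subset_span (Set.mem_insert a G)
    obtain ⟨M, hM, hle⟩ := exists_tMax_ge (K := K)
      (fun h0 => ha (by simpa [h0] using le_tIdealClosure J haJ))
      (fun h' => h ((Ideal.eq_top_iff_one _).1 h')) (isTClosed_tIdealClosure J)
    obtain ⟨s, hs, hsN⟩ := H.exists_notMem_mem_locContraction hM ha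
    exact hs (hle (le_tIdealClosure J
      (Ideal.subset_span (Set.mem_insert_of_mem a ⟨M, hM, hs, hsN⟩))))
  obtain ⟨J', hJ', hJ'J, h1⟩ := h1
  obtain ⟨F, hFG, hJF⟩ : ∃ F : Finset R, (F : Set R) ⊆ insert a G ∧ J' ≤ Ideal.span F := by
    obtain ⟨T, rfl⟩ := hJ'
    obtain ⟨F, hF, hTF⟩ := Submodule.subset_span_finite_of_subset_span (s := insert a G)
      (fun x hx => hJ'J (Submodule.subset_span hx))
    exact ⟨F, hF, Ideal.span_le.2 hTF⟩
  have key : ∀ N ∈ {N ∈ tMax R K | a ∈ N.asIdeal}, ∃ s ∈ F, s ∉ N.asIdeal ∧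
      ∀ N' ∈ {N ∈ tMax R K | a ∈ N.asIdeal}, s ∉ N'.asIdeal → N' = N := by
    rintro N ⟨hN, haN⟩
    obtain ⟨s, hsF, hsN⟩ : ∃ s ∈ F, s ∉ N.asIdeal := by
      by_contra! hcon
      exact N.isPrime.one_notMem (isTClosed_of_mem_tMax hN J' hJ'
        (hJF.trans (Ideal.span_le.2 hcon)) h1)
    refine ⟨s, hsF, hsN, ?_⟩
    rcases hFG hsF with rfl | ⟨M, hM, hsM, hs⟩
    · exact (hsN haN).elim
    have hM' : ∀ N' ∈ {N ∈ tMax R K | a ∈ N.asIdeal}, s ∉ N'.asIdeal → N' = M := by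
      rintro N' ⟨hN', haN'⟩ hsN'
      by_contra hne
      exact hsN' (locContraction_le_of_le le_rfl
        ((Ideal.span_singleton_le_iff_mem _).2 haN') (hs N' hN' hne))
    intro N' hN' hsN'
    rw [hM' N' hN' hsN', hM' N ⟨hN, haN⟩ hsN]
  choose! f hf hfN hfu using key
  refine Set.Finite.of_injOn (f := f) (t := F) (fun N hN => hf N hN) ?_ F.finite_toSet
  intro N hN N' hN' h
  exact hfu N' hN' N hN (h ▸ hfN N hN)

end WDivisorial

/-! ### From divisorial localizations to `w`-divisoriality -/

section Sufficiency

variable {R : Type*} [CommRing R]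

/-- An ideal that lies in no member of a family as below has `t`-closure `R`. -/
theorem exists_fg_one_mem_divClosure {L : Set (PrimeSpectrum R)} (hL : L.Nonempty)
    (hfc : FiniteCharacter L) (hint : IsInterLocalizations L) {I : Ideal R}
    (hI : ∀ P ∈ L, ¬ I ≤ P.asIdeal) : ∃ J : Ideal R, J.FG ∧ J ≤ I ∧ 1 ∈ divClosure J := by
  obtain ⟨P₀, hP₀⟩ := hL
  obtain ⟨x, hxI, hx⟩ := SetLike.not_le_iff_exists.1 (hI P₀ hP₀)
  have hfin := hfc x (fun h => hx (h ▸ P₀.asIdeal.zero_mem))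
  choose! y hyI hyP using fun P (hP : P ∈ L) => SetLike.not_le_iff_exists.1 (hI P hP)
  refine ⟨Ideal.span (insert x (y '' {P ∈ L | x ∈ P.asIdeal})),
    Submodule.fg_span ((hfin.image y).insert x), Ideal.span_le.2 ?_, ?_⟩
  · rintro z (rfl | ⟨P, hP, rfl⟩)
    · exact hxI
    · exact hyI P hP.1
  · intro b c hc h
    rw [mul_one]
    refine hint b c hc fun P hP => mem_locContraction_span.2 ?_
    by_cases hxP : x ∈ P.asIdeal
    · refine ⟨y P, hyP P hP, ?_⟩
      rw [mul_comm]
      exact h _ (Ideal.subset_span (Set.mem_insert_of_mem _ ⟨P, ⟨hP, hxP⟩, rfl⟩))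
    · refine ⟨x, hxP, ?_⟩
      rw [mul_comm]
      exact h _ (Ideal.subset_span (Set.mem_insert _ _))

/-- For an independent family of finite character, `1 / c` is a fraction `r / s` with `s ∉ P` and
`r ∈ R_Q` for each other member `Q`. -/
theorem exists_notMem_mem_locContraction_of_independent {L : Set (PrimeSpectrum R)}
    (hfc : FiniteCharacter L) (hind : Independent L) {P : PrimeSpectrum R} (hP : P ∈ L) {c : R}
    (hc : c ≠ 0) :
    ∃ s ∉ P.asIdeal, ∀ Q ∈ L, Q ≠ P → s ∈ locContraction Q (Ideal.span {c}) := by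
  have key : ∀ Q ∈ L, Q ≠ P → ∃ s ∉ P.asIdeal, s ∈ locContraction Q (Ideal.span {c}) := by
    intro Q hQ hQP
    obtain ⟨s, hs, t, ht, h⟩ := exists_dvd_mul_of_no_common_prime (hind P hP Q hQ hQP.symm) hc
    exact ⟨s, hs, mem_locContraction_span.2 ⟨t, ht, h⟩⟩
  choose! s hs hsQ using key
  have hfin : {Q ∈ L | c ∈ Q.asIdeal ∧ Q ≠ P}.Finite :=
    (hfc c hc).subset fun Q hQ => ⟨hQ.1, hQ.2.1⟩
  refine ⟨∏ Q ∈ hfin.toFinset, s Q, ?_, fun Q hQ hQP => ?_⟩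
  · refine P.isPrime.prod_mem_iff.not.2 ?_
    rintro ⟨Q, hQ, h⟩
    rw [Set.Finite.mem_toFinset] at hQ
    exact hs Q hQ.1 hQ.2.2 h
  · by_cases hcQ : c ∈ Q.asIdeal
    · refine Ideal.mem_of_dvd _ (Finset.dvd_prod_of_mem s ?_) (hsQ Q hQ hQP)
      rw [Set.Finite.mem_toFinset]
      exact ⟨hQ, hcQ, hQP⟩
    · exact mem_locContraction_span.2 ⟨c, hcQ, dvd_mul_right _ _⟩

theorem exists_ge_of_isTClosed {L : Set (PrimeSpectrum R)} (hL : L.Nonempty)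
    (hfc : FiniteCharacter L) (hint : IsInterLocalizations L) {I : Ideal R} (hI : I ≠ ⊤)
    (hI' : IsTClosed I) : ∃ P ∈ L, I ≤ P.asIdeal := by
  by_contra! hcon
  obtain ⟨J, hJ, hJI, h1⟩ := exists_fg_one_mem_divClosure hL hfc hint hcon
  exact hI ((Ideal.eq_top_iff_one _).2 (hI' J hJ hJI h1))

variable [IsDomain R] {K : Type*} [Field K] [Algebra R K] [IsFractionRing R K]

/-- The local-global principle behind sufficiency: localization at `P ∈ L` commutes with
`I ↦ (R : I)`, so that divisoriality of the rings `R_P` gives `I_v ⊆ I R_P`. -/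
theorem divClosureLeW_of_locDivisorial {L : Set (PrimeSpectrum R)} (hL : L.Nonempty)
    (hfc : FiniteCharacter L) (hind : Independent L) (hint : IsInterLocalizations L)
    (h0 : ∀ P ∈ L, P.asIdeal ≠ ⊥) (hdiv : ∀ P ∈ L, LocDivisorial P) : DivClosureLeW R K := by
  intro I hI M hM d hd
  have hML : M ∈ L := by
    obtain ⟨P, hP, hMP⟩ := exists_ge_of_isTClosed hL hfc hint M.isPrime.ne_top
      (isTClosed_of_mem_tMax hM)
    have h := eq_of_mem_tMax_of_le hM P.isPrime.ne_top
      ((hdiv P hP).isTClosed le_rfl (h0 P hP)) hMP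
    rwa [← PrimeSpectrum.ext h]
  refine hdiv M hML I hI d fun b c hc h => ?_
  obtain ⟨s, hs, hsQ⟩ := exists_notMem_mem_locContraction_of_independent hfc hind hML hc
  have h1 : c ∣ (s * b) * d := by
    refine hd _ c hc fun j hj => hint _ c hc fun P hP => ?_
    by_cases hPM : P = M
    · subst hPM
      rw [mul_assoc]
      exact Ideal.mul_mem_left _ _ (h j hj)
    · rw [mul_assoc]
      exact Ideal.mul_mem_right _ _ (hsQ P hP hPM)
  exact mem_locContraction_span.2 ⟨s, hs, by rwa [← mul_assoc]⟩

end Sufficiency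

/-! ### Localizations inside the quotient field -/

section LocalizationsInQuotientField

variable {R : Type*} [CommRing R] {K : Type*} [Field K] [Algebra R K]
  [IsFractionRing R K]

theorem algebraMap_ne_zero_of_notMem {P : PrimeSpectrum R} {s : R} (hs : s ∉ P.asIdeal) :
    algebraMap R K s ≠ 0 := by
  have h : s ≠ 0 := fun h => hs (h ▸ P.asIdeal.zero_mem)
  simpa using h

theorem smul_mem_coeIdeal_iff {I : Ideal R} {s d : R} :
    s • algebraMap R K d ∈ (I : FractionalIdeal R⁰ K) ↔ s * d ∈ I := by
  rw [Algebra.smul_def, ← map_mul, FractionalIdeal.mem_coeIdeal]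
  constructor
  · rintro ⟨r, hr, h⟩
    rwa [← IsFractionRing.injective R K h]
  · exact fun h => ⟨_, h, rfl⟩

/-- Being a divisorial domain depends on the subring of `K` only, not on the base ring over which
it is regarded as a subalgebra. -/
theorem isDivisorialDomain_of_mem_iff {R' : Type*} [CommRing R'] [Algebra R' K]
    [IsFractionRing R' K] {A : Subalgebra R K} {B : Subalgebra R' K} (h : ∀ x, x ∈ A ↔ x ∈ B)
    (hA : IsDivisorialDomain A K) : IsDivisorialDomain B K := by
  rw [isDivisorialDomain_iff] at hA ⊢
  let e : A ≃+* B :=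
    { toFun := fun x => ⟨x, (h x).1 x.2⟩
      invFun := fun x => ⟨x, (h x).2 x.2⟩
      left_inv := fun _ => rfl
      right_inv := fun _ => rfl
      map_mul' := fun _ _ => rfl
      map_add' := fun _ _ => rfl }
  intro I hI x hx
  have h1 : e.symm x ∈ I.comap (e : A →+* B) := by
    refine hA _ (fun h0 => hI ?_) fun b c hc hj => ?_
    · have h2 := Ideal.map_comap_of_surjective (e : A →+* B) e.surjective I
      rw [h0, Ideal.map_bot] at h2
      exact h2.symm
    · have h2 := hx (e b) (e c) (by simpa using hc) fun j hjI => by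
        have h3 := map_dvd e (hj (e.symm j) (by
          change e (e.symm j) ∈ I
          rwa [e.apply_symm_apply]))
        simpa using h3
      simpa using map_dvd e.symm h2
  change e (e.symm x) ∈ I at h1
  rwa [e.apply_symm_apply] at h1

variable [IsDomain R]

theorem mem_localAt {P : PrimeSpectrum R} {x : K} :
    x ∈ localAt K P ↔ ∃ a : R, ∃ s ∉ P.asIdeal, x * algebraMap R K s = algebraMap R K a := by
  constructor
  · rintro ⟨a, s, hs, rfl⟩
    exact ⟨a, s, hs, inv_mul_cancel_right₀ (algebraMap_ne_zero_of_notMem hs) _⟩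
  · rintro ⟨a, s, hs, h⟩
    exact ⟨a, s, hs, (eq_mul_inv_iff_mul_eq₀ (algebraMap_ne_zero_of_notMem hs)).2 h⟩

theorem div_mem_localAt {P : PrimeSpectrum R} {b c : R} (hc : c ≠ 0) :
    algebraMap R K b / algebraMap R K c ∈ localAt K P ↔ b ∈ locContraction P (Ideal.span {c}) := by
  rw [mem_localAt, mem_locContraction_span]
  constructor
  · rintro ⟨a, s, hs, h⟩
    refine ⟨s, hs, ?_⟩
    rw [mul_comm]
    exact (mul_mem_range_iff (K := K) hc).1 ⟨a, h.symm⟩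
  · rintro ⟨s, hs, h⟩
    rw [mul_comm] at h
    obtain ⟨a, ha⟩ := (mul_mem_range_iff (K := K) hc).2 h
    exact ⟨a, s, hs, ha.symm⟩

theorem localAt_antitone {P Q : PrimeSpectrum R} (h : Q ≤ P) : localAt K P ≤ localAt K Q := by
  intro x hx
  obtain ⟨a, s, hs, hx⟩ := mem_localAt.1 hx
  exact mem_localAt.2 ⟨a, s, fun h' => hs (h h'), hx⟩

theorem mem_mul_localAt {M : PrimeSpectrum R} {I : Submodule R K} {x : K} :
    x ∈ I * Subalgebra.toSubmodule (localAt K M) ↔ ∃ s ∉ M.asIdeal, s • x ∈ I := by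
  constructor
  · intro hx
    induction hx using Submodule.mul_induction_on' with
    | mem_mul_mem y hy z hz =>
      obtain ⟨a, s, hs, h⟩ := mem_localAt.1 hz
      refine ⟨s, hs, ?_⟩
      have h1 : s • (y * z) = a • y := by
        rw [Algebra.smul_def, Algebra.smul_def, ← h]
        ring
      rw [h1]
      exact I.smul_mem a hy
    | add y _ z _ hy hz =>
      obtain ⟨s, hs, hy⟩ := hy
      obtain ⟨t, ht, hz⟩ := hz
      refine ⟨s * t, M.isPrime.mul_notMem hs ht, ?_⟩
      rw [smul_add]
      refine I.add_mem ?_ ?_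
      · rw [mul_comm, mul_smul]
        exact I.smul_mem t hy
      · rw [mul_smul]
        exact I.smul_mem s hz
  · rintro ⟨s, hs, hx⟩
    have hs0 := algebraMap_ne_zero_of_notMem (K := K) hs
    have h1 : x = (s • x) * (algebraMap R K s)⁻¹ := by
      rw [Algebra.smul_def]
      field_simp
    rw [h1]
    exact Submodule.mul_mem_mul hx
      (mem_localAt.2 ⟨1, s, hs, by rw [map_one, inv_mul_cancel₀ hs0]⟩)

theorem mem_wClosure {I : FractionalIdeal R⁰ K} {x : K} :
    x ∈ wClosure I ↔ ∀ M ∈ tMax R K, ∃ s ∉ M.asIdeal, s • x ∈ I := by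
  simp only [wClosure, Submodule.mem_iInf, mem_mul_localAt, FractionalIdeal.mem_coe]

theorem le_wClosure (I : FractionalIdeal R⁰ K) : (I : Submodule R K) ≤ wClosure I :=
  fun x hx => mem_wClosure.2 fun M _ => ⟨1, M.isPrime.one_notMem, by simpa using hx⟩

theorem mem_of_forall_mem_localAt {L : Set (PrimeSpectrum R)} (hL : IsInterLocalizations L)
    {x : K} (h : ∀ P ∈ L, x ∈ localAt K P) : ∃ r : R, algebraMap R K r = x := by
  obtain ⟨b, c, hc, rfl⟩ := IsFractionRing.div_surjective R x
  have hc := nonZeroDivisors.ne_zero hc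
  have h1 : c ∣ b * 1 := by
    rw [mul_one]
    exact hL b c hc fun P hP => (div_mem_localAt hc).1 (h P hP)
  simpa using (mul_mem_range_iff (K := K) hc).2 h1

/-- A domain is `w`-divisorial if and only if `I_v ⊆ I_w` for each nonzero integral ideal `I`. -/
theorem isWDivisorial_iff : IsWDivisorial R K ↔ DivClosureLeW R K := by
  constructor
  · intro h I hI M hM d hd
    -- `W` is the ideal `I_w`
    let W : Ideal R := ⨅ M ∈ tMax R K, locContraction M I
    have hIW : I ≤ W := le_iInf₂ fun M _ => le_locContraction M I
    have hW : W ≠ ⊥ := fun h0 => hI (le_bot_iff.1 (h0 ▸ hIW))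
    have hWw : wClosure (W : FractionalIdeal R⁰ K) =
        ((W : FractionalIdeal R⁰ K) : Submodule R K) := by
      refine le_antisymm (fun x hx => ?_) (le_wClosure _)
      rw [mem_wClosure] at hx
      obtain ⟨r, rfl⟩ := mem_of_forall_mem_localAt (isInterLocalizations_tMax R K) (x := x)
        fun N hN => by
          obtain ⟨s, hs, h⟩ := hx N hN
          obtain ⟨a, -, ha⟩ := (FractionalIdeal.mem_coeIdeal _).1 h
          exact mem_localAt.2 ⟨a, s, hs, by rw [ha, Algebra.smul_def, mul_comm]⟩
      refine FractionalIdeal.mem_coeIdeal_of_mem _ ?_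
      simp only [W, Submodule.mem_iInf]
      intro N hN
      obtain ⟨s, hs, h⟩ := hx N hN
      have h := (smul_mem_coeIdeal_iff (K := K)).1 h
      simp only [W, Submodule.mem_iInf] at h
      exact mem_locContraction_of_mul_mem hs (h N hN)
    have h1 := h _ (FractionalIdeal.coeIdeal_ne_zero.2 hW) hWw
    rw [vClosure_coeIdeal hW, FractionalIdeal.coeIdeal_inj] at h1
    have h2 : d ∈ W := h1.le (divClosure_mono hIW hd)
    simp only [W, Submodule.mem_iInf] at h2
    exact h2 M hM
  · intro H I hI hIw
    refine le_antisymm (fun x hx => ?_) fun x hx => ?_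
    · obtain ⟨a, J, ha, hIJ⟩ := FractionalIdeal.exists_eq_spanSingleton_mul I
      have ha' : algebraMap R K a ≠ 0 := by simpa using ha
      have hmem : ∀ y : K, y ∈ I ↔ algebraMap R K a * y ∈ (J : FractionalIdeal R⁰ K) := by
        intro y
        rw [hIJ, FractionalIdeal.mem_singleton_mul]
        constructor
        · rintro ⟨z, hz, rfl⟩
          rwa [mul_inv_cancel_left₀ ha']
        · exact fun h => ⟨_, h, by rw [inv_mul_cancel_left₀ ha']⟩
      have hJ : J ≠ ⊥ := by
        rintro rfl
        rw [FractionalIdeal.coeIdeal_bot, mul_zero] at hIJ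
        exact hI hIJ
      have hJ' : (J : FractionalIdeal R⁰ K) ≠ 0 := FractionalIdeal.coeIdeal_ne_zero.2 hJ
      -- scaling by `a` turns `I_v` into `J_v`
      have hax : algebraMap R K a * x ∈ vClosure (J : FractionalIdeal R⁰ K) := by
        rw [vClosure, FractionalIdeal.mem_div_iff_of_ne_zero (one_div_ne_zero' hI)] at hx
        rw [vClosure, FractionalIdeal.mem_div_iff_of_ne_zero (one_div_ne_zero' hJ')]
        intro y hy
        rw [FractionalIdeal.mem_div_iff_of_ne_zero hJ'] at hy
        have h1 := hx (algebraMap R K a * y) <| by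
          rw [FractionalIdeal.mem_div_iff_of_ne_zero hI]
          intro z hz
          have h2 := hy _ ((hmem z).1 hz)
          rwa [mul_left_comm, ← mul_assoc] at h2
        rwa [mul_left_comm, ← mul_assoc] at h1
      obtain ⟨d, hd, hdx⟩ := (mem_vClosure_coeIdeal hJ).1 hax
      have hxw : x ∈ wClosure I := mem_wClosure.2 fun M hM => by
        obtain ⟨s, hs, h⟩ := H J hJ M hM hd
        refine ⟨s, hs, (hmem _).2 ?_⟩
        rw [mul_smul_comm, ← hdx]
        exact smul_mem_coeIdeal_iff.2 h
      rwa [hIw] at hxw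
    · rw [vClosure, FractionalIdeal.mem_div_iff_of_ne_zero (one_div_ne_zero' hI)]
      intro y hy
      rw [FractionalIdeal.mem_div_iff_of_ne_zero hI] at hy
      rw [mul_comm]
      exact hy x hx

instance isLocalization_localAt (P : PrimeSpectrum R) :
    IsLocalization.AtPrime (localAt K P) P.asIdeal :=
  Localization.subalgebra.isLocalization_ofField K _ _

theorem algebraMap_localAt_dvd {P : PrimeSpectrum R} {b c : R} :
    algebraMap R (localAt K P) c ∣ algebraMap R (localAt K P) b ↔
      b ∈ locContraction P (Ideal.span {c}) := by
  rw [← Ideal.mem_span_singleton, ← Set.image_singleton, ← Ideal.map_span,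
    IsLocalization.algebraMap_mem_map_algebraMap_iff P.asIdeal.primeCompl]
  rfl

theorem isUnit_algebraMap_localAt {P : PrimeSpectrum R} {s : R} (hs : s ∉ P.asIdeal) :
    IsUnit (algebraMap R (localAt K P) s) :=
  IsLocalization.map_units (M := P.asIdeal.primeCompl) (localAt K P) ⟨s, hs⟩

theorem exists_mul_eq_algebraMap_localAt {P : PrimeSpectrum R} (x : localAt K P) :
    ∃ a : R, ∃ s ∉ P.asIdeal, x * algebraMap R (localAt K P) s = algebraMap R (localAt K P) a := by
  obtain ⟨⟨a, s⟩, h⟩ := IsLocalization.surj P.asIdeal.primeCompl x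
  exact ⟨a, s, s.2, h⟩

theorem isDivisorialDomain_localAt_iff {P : PrimeSpectrum R} :
    IsDivisorialDomain (localAt K P) K ↔ LocDivisorial P := by
  rw [isDivisorialDomain_iff]
  have hinj : Function.Injective (algebraMap R (localAt K P)) :=
    FaithfulSMul.algebraMap_injective R (localAt K P)
  constructor
  · intro h I hI d hd
    have h1 : algebraMap R (localAt K P) d ∈ I.map (algebraMap R (localAt K P)) := by
      refine h _ (fun h0 => hI ((Ideal.map_eq_bot_iff_of_injective hinj).1 h0)) ?_
      intro β γ hγ hβ
      obtain ⟨b, s, hs, hb⟩ := exists_mul_eq_algebraMap_localAt β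
      obtain ⟨c, t, ht, hc⟩ := exists_mul_eq_algebraMap_localAt γ
      have hc0 : c ≠ 0 := by
        rintro rfl
        rw [map_zero, (isUnit_algebraMap_localAt ht).mul_left_eq_zero] at hc
        exact hγ hc
      have key : ∀ j : R, γ ∣ β * algebraMap R (localAt K P) j ↔
          b * j ∈ locContraction P (Ideal.span {c}) := by
        intro j
        rw [← algebraMap_localAt_dvd (K := K), map_mul, ← hb, ← hc,
          (isUnit_algebraMap_localAt ht).mul_right_dvd, mul_right_comm,
          (isUnit_algebraMap_localAt hs).dvd_mul_right]
      rw [key]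
      exact hd b c hc0 fun j hj => (key j).1 (hβ _ (Ideal.mem_map_of_mem _ hj))
    rw [IsLocalization.algebraMap_mem_map_algebraMap_iff P.asIdeal.primeCompl] at h1
    exact h1
  · intro h I hI x hx
    obtain ⟨d, s, hs, hd⟩ := exists_mul_eq_algebraMap_localAt x
    have hI0 : I.comap (algebraMap R (localAt K P)) ≠ ⊥ := by
      obtain ⟨y, hyI, hy⟩ := Submodule.exists_mem_ne_zero_of_ne_bot hI
      obtain ⟨a, t, ht, ha⟩ := exists_mul_eq_algebraMap_localAt y
      intro h0
      have h1 : a ∈ I.comap (algebraMap R (localAt K P)) := by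
        rw [Ideal.mem_comap, ← ha]
        exact I.mul_mem_right _ hyI
      rw [h0, Ideal.mem_bot] at h1
      rw [h1, map_zero, (isUnit_algebraMap_localAt ht).mul_left_eq_zero] at ha
      exact hy ha
    have h1 : d ∈ locContraction P (I.comap (algebraMap R (localAt K P))) := by
      refine h _ hI0 d fun b c hc hb => ?_
      rw [← algebraMap_localAt_dvd (K := K), map_mul, ← hd, ← mul_assoc]
      refine Dvd.dvd.mul_right (hx _ _ (fun h0 => hc (hinj (by rw [h0, map_zero]))) ?_) _
      intro y hy
      obtain ⟨a, t, ht, ha⟩ := exists_mul_eq_algebraMap_localAt y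
      rw [← (isUnit_algebraMap_localAt ht).dvd_mul_right, mul_assoc, ha, ← map_mul,
        algebraMap_localAt_dvd]
      refine hb a ?_
      rw [Ideal.mem_comap, ← ha]
      exact I.mul_mem_right _ hy
    obtain ⟨t, ht, h2⟩ := h1
    rw [Ideal.mem_comap, map_mul, ← hd] at h2
    rw [Ideal.unit_mul_mem_iff_mem _ (isUnit_algebraMap_localAt ht)] at h2
    rwa [Ideal.mul_unit_mem_iff_mem _ (isUnit_algebraMap_localAt hs)] at h2

theorem mem_genFractionRing_idealSystem {L : Set (PrimeSpectrum R)} (hL : L.Nonempty) {x : K} :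
    x ∈ genFractionRing K (idealSystem L) (isMultiplicativeSystem_idealSystem hL) ↔
      ∀ P ∈ L, x ∈ localAt K P := by
  have hsys := isMultiplicativeSystem_idealSystem hL
  constructor
  · rintro ⟨J, hJ, hx⟩ P hP
    rw [mem_one_div_coeIdeal (hsys.ne_bot J hJ)] at hx
    obtain ⟨s, hsJ, hs⟩ := SetLike.not_le_iff_exists.1 (hJ P hP)
    obtain ⟨r, hr⟩ := hx s hsJ
    exact mem_localAt.2 ⟨r, s, hs, hr.symm⟩
  · intro h
    obtain ⟨b, c, hc, rfl⟩ := IsFractionRing.div_surjective R x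
    have hc := nonZeroDivisors.ne_zero hc
    have hJ : quotIdeal c b ∈ idealSystem L := by
      intro P hP hle
      obtain ⟨s, hs, hsb⟩ := mem_locContraction_span.1 ((div_mem_localAt hc).1 (h P hP))
      rw [mul_comm] at hsb
      exact hs (hle hsb)
    refine ⟨quotIdeal c b, hJ, ?_⟩
    rw [mem_one_div_coeIdeal (hsys.ne_bot _ hJ)]
    exact fun j hj => (mul_mem_range_iff hc).2 hj

end LocalizationsInQuotientField

/-! ### Centers of primes on an overring -/

section Centers

variable {R : Type*} [CommRing R] {K : Type*} [Field K] [Algebra R K] {T : Subalgebra R K}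

variable (T) in
/-- The contraction to `R` of a prime ideal of an overring. -/
def contraction (N : PrimeSpectrum T) : PrimeSpectrum R :=
  N.comap (algebraMap R T)

theorem mem_contraction {N : PrimeSpectrum T} {r : R} :
    r ∈ (contraction T N).asIdeal ↔ algebraMap R T r ∈ N.asIdeal :=
  Iff.rfl

variable [IsFractionRing R K]

/-- For fractions `x = a / s = b / t` with `s ∉ P`, `t ∉ Q` and `P ≤ Q`, the numerators lie in `P`
simultaneously, so that membership in `P R_P` can be tested on either of them. -/
theorem mul_eq_algebraMap_iff_mem {P Q : PrimeSpectrum R} {x : K} {a b s t : R}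
    (hs : s ∉ P.asIdeal) (hx : x * algebraMap R K s = algebraMap R K a)
    (ht : t ∉ Q.asIdeal) (hQP : P ≤ Q) (hx' : x * algebraMap R K t = algebraMap R K b) :
    a ∈ P.asIdeal ↔ b ∈ P.asIdeal := by
  have h : a * t = b * s := IsFractionRing.injective R K (by
    rw [map_mul, map_mul, ← hx, ← hx']
    ring)
  constructor
  · intro ha
    exact (P.isPrime.mem_or_mem (h ▸ P.asIdeal.mul_mem_right t ha)).resolve_right hs
  · intro hb
    exact (P.isPrime.mem_or_mem (h ▸ P.asIdeal.mul_mem_right s hb)).resolve_right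
      fun h' => ht (hQP h')

variable [IsDomain R] {P Q : PrimeSpectrum R}

/-- The contraction `P R_P ∩ T` of the maximal ideal of `R_P` to a ring `R ⊆ T ⊆ R_P`. -/
def center (h : T ≤ localAt K P) : PrimeSpectrum T where
  asIdeal :=
    { carrier := {x | ∃ a ∈ P.asIdeal, ∃ s ∉ P.asIdeal,
        (x : K) * algebraMap R K s = algebraMap R K a}
      zero_mem' := ⟨0, zero_mem _, 1, P.isPrime.one_notMem, by simp⟩
      add_mem' := by
        rintro x y ⟨a, ha, s, hs, hx⟩ ⟨b, hb, t, ht, hy⟩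
        refine ⟨t * a + s * b, P.asIdeal.add_mem (P.asIdeal.mul_mem_left _ ha)
          (P.asIdeal.mul_mem_left _ hb), s * t, P.isPrime.mul_notMem hs ht, ?_⟩
        rw [map_add, map_mul, map_mul, map_mul, ← hx, ← hy]
        push_cast
        ring
      smul_mem' := by
        rintro y x ⟨a, ha, s, hs, hx⟩
        obtain ⟨b, t, ht, hy⟩ := mem_localAt.1 (h y.2)
        refine ⟨b * a, P.asIdeal.mul_mem_left _ ha, t * s, P.isPrime.mul_notMem ht hs, ?_⟩
        rw [map_mul, map_mul, ← hx, ← hy, smul_eq_mul]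
        push_cast
        ring }
  isPrime := by
    refine ⟨fun htop => ?_, ?_⟩
    · obtain ⟨a, ha, s, hs, h1⟩ := (Ideal.eq_top_iff_one _).1 htop
      rw [OneMemClass.coe_one, one_mul] at h1
      exact hs (IsFractionRing.injective R K h1 ▸ ha)
    · rintro x y ⟨a, ha, s, hs, hxy⟩
      obtain ⟨b, t, ht, hx⟩ := mem_localAt.1 (h x.2)
      obtain ⟨c, u, hu, hy⟩ := mem_localAt.1 (h y.2)
      have h1 : b * c ∈ P.asIdeal := by
        refine (mul_eq_algebraMap_iff_mem hs hxy (P.isPrime.mul_notMem ht hu) le_rfl ?_).1 ha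
        rw [map_mul, map_mul, ← hx, ← hy]
        push_cast
        ring
      rcases P.isPrime.mem_or_mem h1 with hb | hc
      · exact Or.inl ⟨b, hb, t, ht, hx⟩
      · exact Or.inr ⟨c, hc, u, hu, hy⟩

theorem mem_center_iff_of_mul_eq {h : T ≤ localAt K P} {x : T} {a s : R} (hs : s ∉ P.asIdeal)
    (hx : (x : K) * algebraMap R K s = algebraMap R K a) :
    x ∈ (center h).asIdeal ↔ a ∈ P.asIdeal := by
  constructor
  · rintro ⟨b, hb, t, ht, hx'⟩
    exact (mul_eq_algebraMap_iff_mem hs hx ht le_rfl hx').2 hb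
  · exact fun ha => ⟨a, ha, s, hs, hx⟩

theorem algebraMap_mem_center {h : T ≤ localAt K P} {r : R} :
    algebraMap R T r ∈ (center h).asIdeal ↔ r ∈ P.asIdeal :=
  mem_center_iff_of_mul_eq P.isPrime.one_notMem (by rw [map_one, mul_one]; rfl)

theorem contraction_center {h : T ≤ localAt K P} : contraction T (center h) = P :=
  PrimeSpectrum.ext (Ideal.ext fun _ => algebraMap_mem_center (h := h))

theorem center_le_center_iff {hP : T ≤ localAt K P} {hQ : T ≤ localAt K Q} :
    center hP ≤ center hQ ↔ P ≤ Q := by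
  constructor
  · intro h r hr
    exact algebraMap_mem_center.1 (h (algebraMap_mem_center.2 hr))
  · rintro h x ⟨a, ha, s, hs, hx⟩
    obtain ⟨b, t, ht, hx'⟩ := mem_localAt.1 (hQ x.2)
    exact ⟨b, h ((mul_eq_algebraMap_iff_mem hs hx ht h hx').1 ha), t, ht, hx'⟩

theorem center_ne_bot {h : T ≤ localAt K P} (hP : P.asIdeal ≠ ⊥) : (center h).asIdeal ≠ ⊥ := by
  obtain ⟨a, haP, ha⟩ := Submodule.exists_mem_ne_zero_of_ne_bot hP
  intro h0
  have h1 := (algebraMap_mem_center (h := h)).2 haP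
  rw [h0, Ideal.mem_bot] at h1
  exact ha (FaithfulSMul.algebraMap_injective R T (by rw [h1, map_zero]))

theorem mem_localAt_center {h : T ≤ localAt K P} {x : K} :
    x ∈ localAt K (center h) ↔ x ∈ localAt K P := by
  constructor
  · intro hx
    obtain ⟨y, z, hz, hx⟩ := mem_localAt.1 hx
    obtain ⟨a, s, hs, hy⟩ := mem_localAt.1 (h y.2)
    obtain ⟨b, t, ht, hz'⟩ := mem_localAt.1 (h z.2)
    have hb : b ∉ P.asIdeal := fun hb => hz ((mem_center_iff_of_mul_eq ht hz').2 hb)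
    refine mem_localAt.2 ⟨a * t, b * s, P.isPrime.mul_notMem hb hs, ?_⟩
    change x * (z : K) = y at hx
    rw [map_mul, map_mul, ← hy, ← hz', ← hx]
    ring
  · intro hx
    obtain ⟨a, s, hs, hx⟩ := mem_localAt.1 hx
    exact mem_localAt.2 ⟨algebraMap R T a, algebraMap R T s,
      fun h' => hs (algebraMap_mem_center.1 h'), hx⟩

theorem locDivisorial_center_iff {h : T ≤ localAt K P} :
    LocDivisorial (center h) ↔ LocDivisorial P := by
  rw [← isDivisorialDomain_localAt_iff (K := K), ← isDivisorialDomain_localAt_iff (K := K)]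
  exact ⟨isDivisorialDomain_of_mem_iff fun _ => mem_localAt_center,
    isDivisorialDomain_of_mem_iff fun _ => mem_localAt_center.symm⟩

theorem contraction_le {h : T ≤ localAt K P} {N : PrimeSpectrum T} (hN : N ≤ center h) :
    contraction T N ≤ P := fun _ hr => algebraMap_mem_center.1 (hN hr)

/-- A prime ideal inside the center of `P` is the center of its contraction. -/
theorem eq_center_of_le_center {h : T ≤ localAt K P} {N : PrimeSpectrum T} (hN : N ≤ center h) :
    N = center (h.trans (localAt_antitone (contraction_le hN))) := by
  refine PrimeSpectrum.ext (Ideal.ext fun x => ?_)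
  obtain ⟨a, s, hs, hx⟩ := mem_localAt.1 (h x.2)
  have hsN : s ∉ (contraction T N).asIdeal := fun h' => hs (contraction_le hN h')
  have hx' : x * algebraMap R T s = algebraMap R T a := Subtype.ext hx
  rw [mem_center_iff_of_mul_eq hsN hx, mem_contraction, ← hx', N.isPrime.mul_mem_iff_mem_or_mem]
  exact (or_iff_left hsN).symm

theorem contraction_ne_bot (h : T ≤ localAt K P) {N : PrimeSpectrum T}
    (h0 : N.asIdeal ≠ ⊥) : (contraction T N).asIdeal ≠ ⊥ := by
  obtain ⟨x, hxN, hx⟩ := Submodule.exists_mem_ne_zero_of_ne_bot h0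
  obtain ⟨a, s, hs, hxa⟩ := mem_localAt.1 (h x.2)
  have hx' : x * algebraMap R T s = algebraMap R T a := Subtype.ext hxa
  intro hbot
  have ha : a ∈ (contraction T N).asIdeal :=
    mem_contraction.2 (hx' ▸ N.asIdeal.mul_mem_right _ hxN)
  rw [hbot, Ideal.mem_bot] at ha
  rw [ha, map_zero, mul_eq_zero, or_iff_left (algebraMap_ne_zero_of_notMem hs)] at hxa
  exact hx (Subtype.ext hxa)

variable (T) in
/-- The centers on `T` of the members of `L`. -/
def centers (L : Set (PrimeSpectrum R)) : Set (PrimeSpectrum T) :=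
  {N | ∃ P ∈ L, ∃ h : T ≤ localAt K P, N = center h}

theorem isInterLocalizations_centers {L : Set (PrimeSpectrum R)}
    (hT : ∀ x : K, x ∈ T ↔ ∀ P ∈ L, x ∈ localAt K P) : IsInterLocalizations (centers T L) := by
  intro b c hc h
  have h1 : algebraMap T K b / algebraMap T K c ∈ T := (hT _).2 fun P hP => by
    have hTP : T ≤ localAt K P := fun x hx => (hT x).1 hx P hP
    exact mem_localAt_center.1 ((div_mem_localAt hc).2 (h (center hTP) ⟨P, hP, hTP, rfl⟩))
  rw [← mul_one b]
  exact (mul_mem_range_iff (K := K) hc).1 ⟨⟨_, h1⟩, by rw [map_one, mul_one]; rfl⟩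

theorem FiniteCharacter.centers {L : Set (PrimeSpectrum R)} (hL : FiniteCharacter L)
    (hne : L.Nonempty) (hT : ∀ P ∈ L, T ≤ localAt K P) : FiniteCharacter (centers T L) := by
  intro x hx
  obtain ⟨P₀, hP₀⟩ := hne
  obtain ⟨a, s, hs, hxa⟩ := mem_localAt.1 (hT P₀ hP₀ x.2)
  have hx' : x * algebraMap R T s = algebraMap R T a := Subtype.ext hxa
  have ha : a ≠ 0 := by
    rintro rfl
    rw [map_zero, mul_eq_zero, or_iff_left (algebraMap_ne_zero_of_notMem hs)] at hxa
    exact hx (Subtype.ext hxa)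
  refine Set.Finite.of_injOn (f := contraction T) (t := {P ∈ L | a ∈ P.asIdeal}) ?_ ?_ (hL a ha)
  · rintro N ⟨⟨P, hP, h, rfl⟩, hxN⟩
    rw [contraction_center]
    refine ⟨hP, (algebraMap_mem_center (h := h)).1 ?_⟩
    rw [← hx']
    exact Ideal.mul_mem_right _ _ hxN
  · rintro N ⟨⟨P, hP, h, rfl⟩, -⟩ N' ⟨⟨P', hP', h', rfl⟩, -⟩ heq
    have h1 : P = P' := by rwa [contraction_center, contraction_center] at heq
    subst h1
    rfl

theorem Independent.centers {L : Set (PrimeSpectrum R)} (hL : Independent L) :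
    Independent (centers T L) := by
  rintro _ ⟨P, hP, h, rfl⟩ _ ⟨Q, hQ, h', rfl⟩ hne ⟨N, hN, hN0, hNP, hNQ⟩
  have h1 : (⟨N, hN⟩ : PrimeSpectrum T) ≤ center h := hNP
  have h2 : (⟨N, hN⟩ : PrimeSpectrum T) ≤ center h' := hNQ
  refine hL P hP Q hQ (fun hPQ => hne (by subst hPQ; rfl)) ⟨(contraction T ⟨N, hN⟩).asIdeal,
    (contraction T ⟨N, hN⟩).isPrime, contraction_ne_bot h hN0, contraction_le h1,
    contraction_le h2⟩

end Centers

/-! ### `t`-subintersections -/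

section Equivalence

variable {R : Type*} [CommRing R] [IsDomain R] {K : Type*} [Field K] [Algebra R K]
  [IsFractionRing R K]

/-- Sufficient condition for strong `w`-divisoriality: `R = ⋂ R_P` for an independent family of
finite character such that `R_Q` is divisorial for each nonzero prime `Q` inside a member. -/
theorem isStronglyWDivisorial_of_locDivisorial {L : Set (PrimeSpectrum R)} (hL : L.Nonempty)
    (hfc : FiniteCharacter L) (hind : Independent L) (hint : IsInterLocalizations L)
    (h0 : ∀ P ∈ L, P.asIdeal ≠ ⊥)
    (hdiv : ∀ P ∈ L, ∀ Q ≤ P, Q.asIdeal ≠ ⊥ → LocDivisorial Q) : IsStronglyWDivisorial R K := by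
  refine ⟨isWDivisorial_iff.2 (divClosureLeW_of_locDivisorial hL hfc hind hint h0
    fun P hP => hdiv P hP P le_rfl (h0 P hP)), fun Q hQ => ?_⟩
  rw [mem_tSpec_iff] at hQ
  obtain ⟨P, hP, hQP⟩ := exists_ge_of_isTClosed hL hfc hint Q.isPrime.ne_top hQ.2
  exact isDivisorialDomain_localAt_iff.2 (hdiv P hP Q hQP hQ.1)

theorem isStronglyWDivisorial_of_isTSubintersection (hS : IsStronglyWDivisorial R K)
    (hacc : WellFoundedGT (tSpec R K))
    (hfam : ∀ L : Set (PrimeSpectrum R), L.Nonempty → L ⊆ tSpec R K → IsAntichain (· ≤ ·) L →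
      Independent L ∧ FiniteCharacter L)
    {T : Subalgebra R K} (hT : IsTSubintersection T) : IsStronglyWDivisorial T K := by
  obtain ⟨L, hL, hLt, rfl⟩ := hT
  -- the maximal members of `L` define the same intersection
  have hmax : ∀ P ∈ L, ∃ M, P ≤ M ∧ Maximal (· ∈ L) M := by
    intro P hP
    obtain ⟨M, ⟨hPM, hM⟩, hmin⟩ := hacc.wf.has_min
      {M : tSpec R K | P ≤ M.1 ∧ M.1 ∈ L} ⟨⟨P, hLt hP⟩, le_rfl, hP⟩
    refine ⟨M, hPM, hM, fun N hN hMN => ?_⟩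
    by_contra h
    exact hmin ⟨N, hLt hN⟩ ⟨hPM.trans hMN, hN⟩ (lt_of_le_not_ge hMN h)
  let L' : Set (PrimeSpectrum R) := {M | Maximal (· ∈ L) M}
  have hL't : L' ⊆ tSpec R K := fun M hM => hLt hM.1
  have hL'ne : L'.Nonempty := by
    obtain ⟨P, hP⟩ := hL
    obtain ⟨M, -, hM⟩ := hmax P hP
    exact ⟨M, hM⟩
  obtain ⟨hind, hfc⟩ := hfam L' hL'ne hL't fun M hM N hN hne h => hne (hM.eq_of_ge hN.1 h).symm
  have hloc : ∀ P ∈ tSpec R K, LocDivisorial P := fun P hP =>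
    isDivisorialDomain_localAt_iff.1 (hS.2 P hP)
  set T := genFractionRing K (idealSystem L) (isMultiplicativeSystem_idealSystem hL) with hTdef
  have hT : ∀ x : K, x ∈ T ↔ ∀ P ∈ L', x ∈ localAt K P := by
    intro x
    rw [hTdef, mem_genFractionRing_idealSystem hL]
    refine ⟨fun h P hP => h P hP.1, fun h P hP => ?_⟩
    obtain ⟨M, hPM, hM⟩ := hmax P hP
    exact localAt_antitone hPM (h M hM)
  have hTle : ∀ P ∈ L', T ≤ localAt K P := fun P hP x hx => (hT x).1 hx P hP
  refine isStronglyWDivisorial_of_locDivisorial (L := centers T L') ?_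
    (hfc.centers hL'ne hTle) hind.centers (isInterLocalizations_centers hT) ?_ ?_
  · obtain ⟨M, hM⟩ := hL'ne
    exact ⟨center (hTle M hM), M, hM, hTle M hM, rfl⟩
  · rintro _ ⟨P, hP, h, rfl⟩
    exact center_ne_bot (mem_tSpec_iff.1 (hL't hP)).1
  · rintro _ ⟨P, hP, h, rfl⟩ N hN hN0
    have hq0 := contraction_ne_bot h hN0
    rw [eq_center_of_le_center hN, locDivisorial_center_iff]
    exact hloc _ (mem_tSpec_iff.2
      ⟨hq0, (hloc P (hL't hP)).isTClosed (contraction_le hN) hq0⟩)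

theorem tMax_nonempty (hR : ¬ IsField R) : (tMax R K).Nonempty := by
  obtain ⟨a, ha, hau⟩ := Ring.exists_not_isUnit_of_not_isField hR
  have h1 : IsTClosed (quotIdeal a 1) := isTClosed_quotIdeal ha 1
  have h2 : quotIdeal a (1 : R) ≠ ⊤ := fun h => hau (isUnit_of_dvd_one (by
    simpa using mem_quotIdeal.1 ((Ideal.eq_top_iff_one _).1 h)))
  have h3 : quotIdeal a (1 : R) ≠ ⊥ := fun h => ha (by
    have h4 : a ∈ quotIdeal a (1 : R) := mem_quotIdeal.2 (by simp)
    simpa [h] using h4)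
  obtain ⟨M, hM, -⟩ := exists_tMax_ge (K := K) h3 h2 h1
  exact ⟨M, hM⟩

/-- If each `t`-subintersection is strongly `w`-divisorial, then `R_P` is divisorial for each
`t`-prime `P`: the ring `R` itself is a `t`-subintersection, the one of all `t`-maximal ideals. -/
theorem locDivisorial_of_forall_isTSubintersection (hR : ¬ IsField R)
    (h : ∀ T : Subalgebra R K, IsTSubintersection T → IsStronglyWDivisorial T K)
    {P : PrimeSpectrum R} (hP : P ∈ tSpec R K) : LocDivisorial P := by
  have hne : (tMax R K).Nonempty := tMax_nonempty hR
  have hS := h _ ⟨tMax R K, hne, fun M hM => mem_tSpec_of_mem_tMax hM, rfl⟩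
  set T := genFractionRing K (idealSystem (tMax R K)) (isMultiplicativeSystem_idealSystem hne)
    with hT
  have hsurj : Function.Surjective (algebraMap R T) := by
    intro x
    obtain ⟨r, hr⟩ := mem_of_forall_mem_localAt (isInterLocalizations_tMax R K)
      ((mem_genFractionRing_idealSystem hne).1 x.2)
    exact ⟨r, Subtype.ext hr⟩
  let e : R ≃+* T :=
    RingEquiv.ofBijective (algebraMap R T) ⟨FaithfulSMul.algebraMap_injective R T, hsurj⟩
  have hTP : T ≤ localAt K P := by
    intro x hx
    obtain ⟨r, hr⟩ := hsurj ⟨x, hx⟩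
    have hr' : algebraMap R K r = x := congrArg Subtype.val hr
    rw [← hr']
    exact (localAt K P).algebraMap_mem r
  rw [mem_tSpec_iff] at hP
  have h1 : center hTP ∈ tSpec T K := by
    refine mem_tSpec_iff.2 ⟨center_ne_bot hP.1, ?_⟩
    have h2 : (center hTP).asIdeal = P.asIdeal.comap (e.symm : T →+* R) := by
      ext x
      obtain ⟨r, rfl⟩ := hsurj x
      rw [algebraMap_mem_center]
      change r ∈ P.asIdeal ↔ e.symm (e r) ∈ P.asIdeal
      rw [e.symm_apply_apply]
    rw [h2]
    exact isTClosed_comap_ringEquiv e.symm hP.2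
  exact locDivisorial_center_iff.1 (isDivisorialDomain_localAt_iff.1 (hS.2 _ h1))

/-- A `t`-maximal ideal of `⋂ R_P`, `P ∈ L`, is contained in the center of a member of `L`. -/
theorem exists_tMax_le_center {L : Set (PrimeSpectrum R)} {T : Subalgebra R K}
    (hT : ∀ x : K, x ∈ T ↔ ∀ P ∈ L, x ∈ localAt K P) (hTw : IsWDivisorial T K)
    {N : PrimeSpectrum T} (hN : N ∈ tMax T K) :
    ∃ P ∈ L, ∃ h : T ≤ localAt K P, N ≤ center h := by
  obtain ⟨_, ⟨P, hP, h, rfl⟩, hle⟩ := (isWDivisorial_iff.1 hTw).exists_ge_of_isInterLocalizations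
    (isInterLocalizations_centers hT) hN
  exact ⟨P, hP, h, hle⟩

theorem isTClosed_center {P : PrimeSpectrum R} {T : Subalgebra R K} {h : T ≤ localAt K P}
    (hP : LocDivisorial P) (h0 : P.asIdeal ≠ ⊥) : IsTClosed (center h).asIdeal :=
  (locDivisorial_center_iff.2 hP).isTClosed le_rfl (center_ne_bot h0)

/-- The ascending chain condition on `t`-primes: if `N` is `t`-maximal in `⋂ R_P`, `P ∈ L`, then
`N` is the center of a maximal member of `L`. -/
theorem wellFoundedGT_tSpec (hloc : ∀ P ∈ tSpec R K, LocDivisorial P)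
    (h : ∀ T : Subalgebra R K, IsTSubintersection T → IsStronglyWDivisorial T K) :
    WellFoundedGT (tSpec R K) := by
  refine ⟨WellFounded.wellFounded_iff_has_min.2 fun C hC => ?_⟩
  let L : Set (PrimeSpectrum R) := (↑) '' C
  have hL : L.Nonempty := hC.image _
  have hLt : L ⊆ tSpec R K := by
    rintro _ ⟨P, -, rfl⟩
    exact P.2
  have hTw := h _ ⟨L, hL, hLt, rfl⟩
  set T := genFractionRing K (idealSystem L) (isMultiplicativeSystem_idealSystem hL)
  have hT : ∀ x : K, x ∈ T ↔ ∀ P ∈ L, x ∈ localAt K P := fun x =>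
    mem_genFractionRing_idealSystem hL
  have hTle : ∀ P ∈ L, T ≤ localAt K P := fun P hP x hx => (hT x).1 hx P hP
  have hclosed : ∀ P (hP : P ∈ L), IsTClosed (center (hTle P hP)).asIdeal := fun P hP =>
    isTClosed_center (hloc P (hLt hP)) (mem_tSpec_iff.1 (hLt hP)).1
  obtain ⟨P₀, hP₀⟩ := hL
  obtain ⟨N, hN, -⟩ := exists_tMax_ge (K := K) (center_ne_bot (mem_tSpec_iff.1 (hLt hP₀)).1)
    (center (hTle P₀ hP₀)).isPrime.ne_top (hclosed P₀ hP₀)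
  obtain ⟨_, ⟨P, hPC, rfl⟩, hTP, hNP⟩ := exists_tMax_le_center hT hTw.1 hN
  refine ⟨P, hPC, fun Q hQC hPQ => ?_⟩
  have hQL : Q.1 ∈ L := ⟨Q, hQC, rfl⟩
  have hPQ' : P.1 ≤ Q.1 := le_of_lt hPQ
  have h1 : center hTP ≤ center (hTle Q hQL) := center_le_center_iff.2 hPQ'
  have h2 := eq_of_mem_tMax_of_le hN (center (hTle Q hQL)).isPrime.ne_top (hclosed Q hQL)
    (hNP.trans h1)
  have h3 : center (hTle Q hQL) ≤ center hTP := h2.le.trans hNP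
  exact (not_le_of_gt hPQ) (center_le_center_iff.1 h3)

/-- For a family `L` of incomparable `t`-primes the centers on `⋂ R_P`, `P ∈ L`, are `t`-maximal,
so that `L` inherits independence and finite character from them. -/
theorem independent_and_finiteCharacter_of_isAntichain
    (hloc : ∀ P ∈ tSpec R K, LocDivisorial P)
    (h : ∀ T : Subalgebra R K, IsTSubintersection T → IsStronglyWDivisorial T K)
    {L : Set (PrimeSpectrum R)} (hL : L.Nonempty) (hLt : L ⊆ tSpec R K)
    (hanti : IsAntichain (· ≤ ·) L) : Independent L ∧ FiniteCharacter L := by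
  have hTw := h _ ⟨L, hL, hLt, rfl⟩
  set T := genFractionRing K (idealSystem L) (isMultiplicativeSystem_idealSystem hL)
  have hT : ∀ x : K, x ∈ T ↔ ∀ P ∈ L, x ∈ localAt K P := fun x =>
    mem_genFractionRing_idealSystem hL
  have hTle : ∀ P ∈ L, T ≤ localAt K P := fun P hP x hx => (hT x).1 hx P hP
  have hmax : ∀ P (hP : P ∈ L), center (hTle P hP) ∈ tMax T K := by
    intro P hP
    obtain ⟨N, hN, hPN⟩ := exists_tMax_ge (K := K) (center_ne_bot (mem_tSpec_iff.1 (hLt hP)).1)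
      (center (hTle P hP)).isPrime.ne_top
      (isTClosed_center (hloc P (hLt hP)) (mem_tSpec_iff.1 (hLt hP)).1)
    obtain ⟨Q, hQ, hTQ, hNQ⟩ := exists_tMax_le_center hT hTw.1 hN
    have hPQ : P ≤ Q := center_le_center_iff.1 (show center (hTle P hP) ≤ center hTQ from
      fun x hx => hNQ (hPN hx))
    obtain rfl : P = Q := hanti.eq hP hQ hPQ
    have h1 : center (hTle P hP) = N := le_antisymm hPN hNQ
    rwa [h1]
  have H := isWDivisorial_iff.1 hTw.1
  constructor
  · rintro P hP Q hQ hPQ ⟨q, hq, hq0, hqP, hqQ⟩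
    have hqP' : (⟨q, hq⟩ : PrimeSpectrum R) ≤ P := hqP
    have hTq : T ≤ localAt K ⟨q, hq⟩ := (hTle P hP).trans (localAt_antitone hqP')
    refine H.independent _ (hmax P hP) _ (hmax Q hQ) (fun heq => hPQ ?_)
      ⟨(center hTq).asIdeal, (center hTq).isPrime, center_ne_bot hq0,
        center_le_center_iff.2 hqP', center_le_center_iff.2 hqQ⟩
    exact le_antisymm (center_le_center_iff.1 heq.le) (center_le_center_iff.1 heq.ge)
  · intro x hx
    have hx' : algebraMap R T x ≠ 0 := fun h0 =>
      hx (FaithfulSMul.algebraMap_injective R T (by rw [h0, map_zero]))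
    refine ((H.finiteCharacter _ hx').image (contraction T)).subset ?_
    rintro P ⟨hP, hxP⟩
    refine ⟨center (hTle P hP), ⟨hmax P hP, algebraMap_mem_center.2 hxP⟩, contraction_center⟩

end Equivalence

end WDiv

theorem mainTheorem4 (R : Type*) [CommRing R] [IsDomain R] (K : Type*) [Field K] [Algebra R K]
    [IsFractionRing R K] (hR : ¬ IsField R) :
    (∀ T : Subalgebra R K, WDiv.IsTSubintersection T → WDiv.IsStronglyWDivisorial T K) ↔
      (WDiv.IsStronglyWDivisorial R K ∧
        WellFoundedGT (WDiv.tSpec R K) ∧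
        ∀ L : Set (PrimeSpectrum R), L.Nonempty → L ⊆ WDiv.tSpec R K → IsAntichain (· ≤ ·) L →
          WDiv.Independent L ∧ WDiv.FiniteCharacter L) := by
  constructor
  · intro h
    have hloc : ∀ P ∈ WDiv.tSpec R K, WDiv.LocDivisorial P := fun P hP =>
      WDiv.locDivisorial_of_forall_isTSubintersection hR h hP
    have hfam : ∀ L : Set (PrimeSpectrum R), L.Nonempty → L ⊆ WDiv.tSpec R K →
        IsAntichain (· ≤ ·) L → WDiv.Independent L ∧ WDiv.FiniteCharacter L :=
      fun L hL hLt hanti =>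
        WDiv.independent_and_finiteCharacter_of_isAntichain hloc h hL hLt hanti
    refine ⟨?_, WDiv.wellFoundedGT_tSpec hloc h, hfam⟩
    have hne : (WDiv.tMax R K).Nonempty := WDiv.tMax_nonempty hR
    have hmax : WDiv.tMax R K ⊆ WDiv.tSpec R K := fun M hM => WDiv.mem_tSpec_of_mem_tMax hM
    obtain ⟨hind, hfc⟩ := hfam _ hne hmax fun M hM N hN hMN hle => hMN
      (PrimeSpectrum.ext (WDiv.eq_of_mem_tMax_of_le hM N.isPrime.ne_top
        (WDiv.isTClosed_of_mem_tMax hN) hle).symm)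
    refine WDiv.isStronglyWDivisorial_of_locDivisorial hne hfc hind
      (WDiv.isInterLocalizations_tMax R K) (fun M hM => WDiv.ne_bot_of_mem_tMax hM)
      fun M hM Q hQM hQ0 => hloc Q (WDiv.mem_tSpec_iff.2 ⟨hQ0, ?_⟩)
    exact (hloc M (hmax hM)).isTClosed hQM hQ0
  · rintro ⟨hS, hacc, hfam⟩ T hT
    exact WDiv.isStronglyWDivisorial_of_isTSubintersection hS hacc hfam hT
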